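/- Let $\mathbb{D}^*=\{z\in\mathbb{C}: 0<|z|<1\}$ and let $H(\mathbb{D}^*)$ be the space of holomorphic functions on $\mathbb{D}^*$ with the compact-open topology. Let $\omega:\mathbb{D}^*\to\mathbb{C}$ and $\psi:\mathbb{D}^*\to\mathbb{D}^*$ be holomorphic, and let $C_{\omega,\psi}$ be the operator on $H(\mathbb{D}^*)$ given by $(C_{\omega,\psi}f)(z)=\omega(z)f(\psi(z))$ $(z\in\mathbb{D}^*)$. For a continuous linear operator $T$ on a separable Fréchet space $X$ we say that - $T$ is *hypercyclic* if for some $f\in X$ the orbit $\{T^nf: n=0,1,2,\dots\}$ is dense in $X$; - $T$ is *frequently hypercyclic* if for some $f\in X$, $\liminf_{N\to\infty}\frac{\mathrm{card}\{0\le n\le N:\ T^nf\in U\}}{N+1}>0$ for every non-empty open $U\subseteq X$; - $T$ is *topologically transitive* (respectively, *mixing*) if for all non-empty open $U,V\subseteq X$ there is an integer $n\ge 0$ with $T^n(U)\cap V\neq\emptyset$ (respectively, with $T^k(U)\cap V\ne\emptyset$ for all $k\ge n$); - $T$ is *chaotic* if it is topologically transitive and $\{f\in X: T^rf=f\text{ for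 some integer } r\ge1\}$ is dense in $X$; - $T$ satisfies the *Frequent Hypercyclicity Criterion* if there are a dense subset $X_0\subseteq X$ and a map $S:X_0\to X_0$ such that for every $f\in X_0$ the series $\sum_{n=1}^\infty T^nf$ and $\sum_{n=1}^\infty S^nf$ converge unconditionally and $TSf=f$. **Theorem 1.4.** The following are equivalent: 1. $C_{\omega,\psi}$ is hypercyclic on $H(\mathbb{D}^*)$. 2. $C_{\omega,\psi}$ satisfies the Frequent Hypercyclicity Criterion on $H(\mathbb{D}^*)$ (and in particular, it is then frequently hypercyclic, mixing and chaotic). 3. There are an integer $n\ge1$ and $W\in H(\mathbb{D}^*)$ with $\omega(z)=z^ne^{W(z)}$ for all $z\in\mathbb{D}^*$, and $\psi:\mathbb{D}^*\to\mathbb{D}^*$ is injective, not surjective, and satisfies $\lim_{z\to0}\psi(z)=0$. -/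

import Mathlib

open Set Filter Topology

/-! ### Notions of linear dynamics -/

namespace LinDyn

variable {X : Type*} [AddCommMonoid X] [Module ℂ X] [TopologicalSpace X]

/-- `T` is hypercyclic: some orbit `{Tⁿ f : n = 0, 1, …}` is dense. -/
def Hypercyclic (T : X →L[ℂ] X) : Prop :=
  ∃ f : X, Dense (range fun n : ℕ => T^[n] f)

/-- `T` is topologically transitive. -/
def Transitive (T : X →L[ℂ] X) : Prop :=
  ∀ U V : Set X, IsOpen U → IsOpen V → U.Nonempty → V.Nonempty →
    ∃ n : ℕ, (T^[n] '' U ∩ V).Nonempty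

/-- `T` is (topologically) mixing. -/
def Mixing (T : X →L[ℂ] X) : Prop :=
  ∀ U V : Set X, IsOpen U → IsOpen V → U.Nonempty → V.Nonempty →
    ∃ n : ℕ, ∀ k ≥ n, (T^[k] '' U ∩ V).Nonempty

/-- `T` is chaotic: it is topologically transitive and has a dense set of periodic points. -/
def Chaotic (T : X →L[ℂ] X) : Prop :=
  Transitive T ∧ Dense {f : X | ∃ r : ℕ, 1 ≤ r ∧ T^[r] f = f}

/-- `T` is frequently hypercyclic: the orbit of some `f` visits every non-empty open set along a
set of times of positive lower density. -/
def FrequentlyHypercyclic (T : X →L[ℂ] X) : Prop :=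
  ∃ f : X, ∀ U : Set X, IsOpen U → U.Nonempty →
    0 < liminf (fun N : ℕ => ({n : ℕ | n ≤ N ∧ T^[n] f ∈ U}.ncard : ℝ) / ((N : ℝ) + 1)) atTop

/-- `T` satisfies the Frequent Hypercyclicity Criterion. The map `S : X₀ → X₀` is a map of the
subtype, and `Summable` is unconditional convergence. -/
def FrequentHypercyclicityCriterion (T : X →L[ℂ] X) : Prop :=
  ∃ X₀ : Set X, Dense X₀ ∧ ∃ S : X₀ → X₀, ∀ f : X₀,
    Summable (fun n : ℕ => T^[n + 1] (f : X)) ∧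
    Summable (fun n : ℕ => ((S^[n + 1] f : X₀) : X)) ∧
    T (S f : X) = f

end LinDyn

/-! ### Spaces of holomorphic functions and weighted composition operators -/

/-- The punctured unit disc. -/
def puncturedDisc : Set ℂ := Metric.ball (0 : ℂ) 1 \ {0}

theorem isOpen_puncturedDisc : IsOpen puncturedDisc :=
  Metric.isOpen_ball.sdiff isClosed_singleton

/-- `H(Ω)`, for an open set `Ω ⊆ ℂ`: the holomorphic functions on `Ω`, as a subspace of the space
`C(Ω, ℂ)` of continuous functions, which carries the compact-open topology. -/
def HolSpace (Ω : Set ℂ) : Submodule ℂ C(Ω, ℂ) where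
  carrier := {f | ∃ F : ℂ → ℂ, DifferentiableOn ℂ F Ω ∧ ∀ z : Ω, f z = F z}
  add_mem' := by
    rintro f g ⟨F, hF, hf⟩ ⟨G, hG, hg⟩
    exact ⟨fun z => F z + G z, hF.add hG, fun z => by simp [hf, hg]⟩
  zero_mem' := ⟨fun _ => 0, differentiableOn_const 0, fun _ => rfl⟩
  smul_mem' := by
    rintro c f ⟨F, hF, hf⟩
    exact ⟨fun z => c * F z, hF.const_mul c, fun z => by simp [hf]⟩

/-- The weighted composition operator `C_{ω,ψ} : H(Ω) → H(Ω)`,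
`(C_{ω,ψ} f)(z) = ω(z) f(ψ(z))` for `z ∈ Ω` (`Ω` open), as a continuous linear operator. -/
noncomputable def weightedComp (Ω : Set ℂ) (hΩ : IsOpen Ω) (ω ψ : ℂ → ℂ)
    (hω : DifferentiableOn ℂ ω Ω) (hψ : DifferentiableOn ℂ ψ Ω) (hm : MapsTo ψ Ω Ω) : HolSpace Ω →L[ℂ] HolSpace Ω where
  toFun f :=
    ⟨⟨fun z : Ω => ω z * f.1 ⟨ψ z, hm z.2⟩,
      (continuousOn_iff_continuous_domRestrict.1 hω.continuousOn).mul
        (f.1.continuous.comp ((continuousOn_iff_continuous_domRestrict.1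
          hψ.continuousOn).subtype_mk fun z => hm z.2))⟩, by
      obtain ⟨F, hF, hf⟩ := f.2
      exact ⟨fun z => ω z * F (ψ z), hω.mul (hF.comp hψ hm), fun z => by simp [hf]⟩⟩
  map_add' f g := by
    ext z
    exact mul_add _ _ _
  map_smul' c f := by
    ext z
    exact mul_left_comm _ _ _
  cont := by
    have : LocallyCompactSpace Ω := hΩ.locallyCompactSpace
    refine Continuous.subtype_mk ?_ _
    let w : C(Ω, ℂ) := ⟨fun z => ω z, continuousOn_iff_continuous_domRestrict.1 hω.continuousOn⟩
    let p : C(Ω, Ω) := ⟨fun z => ⟨ψ z, hm z.2⟩,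
      (continuousOn_iff_continuous_domRestrict.1 hψ.continuousOn).subtype_mk fun z => hm z.2⟩
    exact (continuous_const (y := w)).mul
      ((ContinuousMap.continuous_precomp p).comp continuous_subtype_val)

/-!
The dynamical consequences of the Frequent Hypercyclicity Criterion only use that a dense set of
points has summable two-sided orbits (`LinDyn.HasSummableBiorbits`). Sums of a two-sided orbit along
a progression of large step are periodic points, and a series of translates of two-sided orbits,
placed at widely separated times of positive lower density, is a frequently hypercyclic vector.

Suppose that `ω = zⁿ exp W` and that `ψ` is injective, not surjective, and extends by `ψ(0) = 0`.
By the Schwarz lemma `λ = ψ'(0)` satisfies `0 < |λ| < 1`. The Koenigs function `σ` is an injective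
coordinate on the disc with `σ ∘ ψ = λ σ` (`exists_koenigs`). A holomorphic function on `𝔻*` splits
into a function holomorphic at `0` and an entire function of `1 / σ`; both parts can be summed along
forward orbits, so the cohomological equation `G - G ∘ ψ = W - c` has a solution
(`exists_sub_comp_eq_sub_const`). With `g = exp G` as gauge the weight becomes `c σⁿ`
(`exists_linear_model`), and the operator shifts the functions `e m = g σᵐ`, `m ∈ ℤ`:
`e m ↦ c λᵐ e (m + n)`. For `n ≥ 1` the weights along the forward orbit tend to zero geometrically,
and so do the inverse weights `(c λ^(m - n))⁻¹` along the backward orbit, where `m` decreases. Hence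
both orbits of each `e m` are summable (`frequentHypercyclicityCriterion_of_model`). The span of the
`e m` is dense (`dense_span_mul_zpow`), by the same splitting and a Runge theorem for polynomials in
an injective function, `exists_polynomial_comp_approx`: the latter is Cauchy's formula in a closed
subalgebra of the continuous functions, whose resolvents are controlled by the connectedness of the
outer annulus.

Conversely, a continuous functional vanishes as soon as it vanishes on the range of a hypercyclic
operator, is an eigenvector of its adjoint, or is bounded on each orbit. Applied to evaluations this
shows that `ω` has no zeros and that `ψ` is injective; applied to a residue, that `ψ(0) = 0`
(`extension_zero_eq_zero_of_hypercyclic`). Rotations are excluded by multiplicative bounds for the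
weight cocycle on a circle (`not_hypercyclic_of_rotation`). So `|λ| < 1`, and the model is available
with `n ∈ ℤ` the winding number of `ω`. For `n = 0` the constant Laurent coefficient in the model is
an eigenvector of the adjoint, and for `n < 0` it is bounded on each orbit
(`one_le_of_hypercyclic_of_model`), so that `n ≥ 1`.
-/

namespace LinDyn

/-! ### Times with large gaps and positive lower density -/

/-- An increasing sequence of times whose gaps `spacedTime (i + 1) - spacedTime i` exceed the sum of
the 2-adic valuations of `i` and `i + 1`; it still grows linearly, since 2-adic valuations are
bounded in the mean. -/
def spacedTime (i : ℕ) : ℕ :=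
  ∑ j ∈ Finset.range i, (padicValNat 2 j + padicValNat 2 (j + 1) + 1)

theorem spacedTime_succ (i : ℕ) :
    spacedTime (i + 1) = spacedTime i + (padicValNat 2 i + padicValNat 2 (i + 1) + 1) :=
  Finset.sum_range_succ _ _

theorem spacedTime_strictMono : StrictMono spacedTime :=
  strictMono_nat_of_lt_succ fun i => by rw [spacedTime_succ]; omega

theorem spacedTime_gap {i j : ℕ} (h : i < j) :
    spacedTime i + padicValNat 2 i + padicValNat 2 j < spacedTime j := by
  obtain ⟨k, rfl⟩ : ∃ k, j = k + 1 := ⟨j - 1, by omega⟩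
  rcases (Nat.lt_succ_iff.1 h).eq_or_lt with rfl | hik
  · rw [spacedTime_succ]; omega
  · have h1 := spacedTime_strictMono.monotone (Nat.succ_le_of_lt hik)
    rw [Nat.succ_eq_add_one, spacedTime_succ] at h1
    rw [spacedTime_succ]; omega

theorem padicValNat_le_spacedTime (i : ℕ) : padicValNat 2 i ≤ spacedTime i := by
  cases i with
  | zero => simp
  | succ k => rw [spacedTime_succ]; omega

theorem spacedTime_add_padicValNat (i : ℕ) :
    spacedTime i + padicValNat 2 i = 2 * padicValNat 2 i.factorial + i := by
  induction i with
  | zero => simp [spacedTime]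
  | succ k ih =>
    rw [spacedTime_succ, Nat.factorial_succ,
      padicValNat.mul k.succ_ne_zero (Nat.factorial_ne_zero k), Nat.succ_eq_add_one]
    omega

theorem spacedTime_le (i : ℕ) : spacedTime i ≤ 3 * i := by
  have h := spacedTime_add_padicValNat i
  have h2 := sub_one_mul_padicValNat_factorial (p := 2) i
  omega

theorem padicValNat_two_pow_mul_odd (ν j : ℕ) : padicValNat 2 (2 ^ ν * (2 * j + 1)) = ν := by
  rw [padicValNat.mul (by positivity) (by omega), padicValNat.prime_pow,
    padicValNat.eq_zero_of_not_dvd (by omega), add_zero]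

/-- There are families of times `τ ν 0, τ ν 1, …`, one for each `ν`, of positive lower density,
such that different times of the families `ν` and `μ` are more than `ν + μ` apart. -/
theorem exists_separated_times : ∃ τ : ℕ → ℕ → ℕ,
    (∀ ν j, ν ≤ τ ν j) ∧
    (∀ ν j μ k, (ν, j) ≠ (μ, k) → ((ν + μ : ℕ) : ℤ) < |(τ ν j : ℤ) - τ μ k|) ∧
    ∀ ν j, τ ν j ≤ 6 * 2 ^ ν * (j + 1) := by
  refine ⟨fun ν j => spacedTime (2 ^ ν * (2 * j + 1)), fun ν j => ?_, fun ν j μ k h => ?_,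
    fun ν j => ?_⟩
  · have := padicValNat_le_spacedTime (2 ^ ν * (2 * j + 1))
    rwa [padicValNat_two_pow_mul_odd] at this
  · have hne : 2 ^ ν * (2 * j + 1) ≠ 2 ^ μ * (2 * k + 1) := by
      intro he
      have hν : ν = μ := by
        rw [← padicValNat_two_pow_mul_odd ν j, he, padicValNat_two_pow_mul_odd]
      subst hν
      have := Nat.eq_of_mul_eq_mul_left (by positivity) he
      exact h (by rw [show j = k by omega])
    dsimp only
    rcases hne.lt_or_gt with hlt | hlt
    · have := spacedTime_gap hlt
      rw [padicValNat_two_pow_mul_odd, padicValNat_two_pow_mul_odd] at this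
      rw [abs_of_nonpos (by omega)]
      omega
    · have := spacedTime_gap hlt
      rw [padicValNat_two_pow_mul_odd, padicValNat_two_pow_mul_odd] at this
      rw [abs_of_nonneg (by omega)]
      omega
  · refine (spacedTime_le _).trans ?_
    nlinarith [pow_pos (show 0 < 2 by norm_num) ν]

/-- A set of times containing an injective sequence of at most linear growth has positive lower
density. -/
theorem liminf_ncard_pos {A : Set ℕ} {t : ℕ → ℕ} (ht : Function.Injective t) {C : ℕ}
    (hC : ∀ j, t j ≤ C * (j + 1)) (hA : ∀ j, t j ∈ A) :
    0 < liminf (fun N : ℕ => ({n : ℕ | n ≤ N ∧ n ∈ A}.ncard : ℝ) / ((N : ℝ) + 1)) atTop := by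
  have hCpos : 0 < C := by
    rcases Nat.eq_zero_or_pos C with rfl | h
    · have h0 := hC 0
      have h1 := hC 1
      have := ht (show t 0 = t 1 by omega)
      omega
    · exact h
  have hle : ∀ N : ℕ, ((N : ℝ) / C - 1) ≤ ({n : ℕ | n ≤ N ∧ n ∈ A}.ncard : ℝ) := by
    intro N
    have h1 : N / C ≤ {n : ℕ | n ≤ N ∧ n ∈ A}.ncard := by
      have hfin : {n : ℕ | n ≤ N ∧ n ∈ A}.Finite := (finite_le_nat N).subset fun n hn => hn.1
      have hsub : t '' (Finset.range (N / C)) ⊆ {n : ℕ | n ≤ N ∧ n ∈ A} := by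
        rintro _ ⟨j, hj, rfl⟩
        rw [Finset.coe_range, mem_Iio] at hj
        refine ⟨(hC j).trans ?_, hA j⟩
        calc C * (j + 1) ≤ C * (N / C) := Nat.mul_le_mul_left _ hj
          _ ≤ N := Nat.mul_div_le N C
      have := ncard_le_ncard hsub hfin
      rwa [ncard_image_of_injective _ ht, ncard_coe_finset, Finset.card_range] at this
    have h2 : (N : ℝ) < C * ((N / C : ℕ) + 1) := by
      exact_mod_cast Nat.lt_mul_div_succ N hCpos
    have h3 : ((N / C : ℕ) : ℝ) ≤ ({n : ℕ | n ≤ N ∧ n ∈ A}.ncard : ℝ) := by exact_mod_cast h1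
    have h4 : (N : ℝ) / C < (N / C : ℕ) + 1 := by
      rw [div_lt_iff₀ (by exact_mod_cast hCpos)]; linarith
    linarith
  have hC' : (0 : ℝ) < C := by exact_mod_cast hCpos
  refine lt_of_lt_of_le (show (0 : ℝ) < 1 / (2 * C) by positivity) (le_liminf_of_le ?_ ?_)
  · refine IsBoundedUnder.isCoboundedUnder_ge ⟨1, eventually_map.2 (Eventually.of_forall fun N => ?_)⟩
    refine (div_le_one (by positivity)).2 ?_
    have : {n : ℕ | n ≤ N ∧ n ∈ A}.ncard ≤ (Finset.range (N + 1)).card := by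
      rw [← ncard_coe_finset]
      exact ncard_le_ncard (fun n hn => by simpa [Nat.lt_succ_iff] using hn.1) (Finset.finite_toSet _)
    rw [Finset.card_range] at this
    exact_mod_cast this
  · filter_upwards [eventually_ge_atTop (2 * C + 1)] with N hN
    have hN' : (2 * C + 1 : ℝ) ≤ N := by exact_mod_cast hN
    rw [le_div_iff₀ (by positivity)]
    refine le_trans ?_ (hle N)
    rw [div_mul_eq_mul_div, one_mul, div_le_iff₀ (by positivity)]
    have : ((N : ℝ) / C - 1) * (2 * C) = 2 * N - 2 * C := by field_simp
    rw [this]; linarith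

/-! ### Consequences of the Frequent Hypercyclicity Criterion -/

/-- If all finite sums that omit the index `i` are small, the sum of the series is close to its term `f i`. -/
theorem sub_mem_of_finset_sum_mem {X : Type*} [AddCommGroup X] [TopologicalSpace X] [IsTopologicalAddGroup X]
    {ι : Type*} {f : ι → X} {s : X} (h : HasSum f s) (i : ι) {V W : Set X} (hV : V ∈ 𝓝 0)
    (hVW : ∀ a ∈ V, ∀ b ∈ V, a + b ∈ W) (hF : ∀ F : Finset ι, i ∉ F → ∑ k ∈ F, f k ∈ V) :
    s - f i ∈ W := by
  classical
  have h1 : Tendsto (fun F : Finset ι => s - ∑ k ∈ F, f k) atTop (𝓝 0) := by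
    simpa using (tendsto_const_nhds (x := s)).sub h
  obtain ⟨F, hF1, hF2⟩ := ((h1.eventually hV).and (eventually_ge_atTop {i})).exists
  have hi : i ∈ F := Finset.singleton_subset_iff.1 hF2
  have := hVW _ hF1 _ (hF (F.erase i) (by simp))
  rwa [← Finset.add_sum_erase F f hi, sub_add_eq_sub_sub, sub_add_cancel] at this

theorem exists_forall_finset_sum_mem {X : Type*} [AddCommGroup X] [TopologicalSpace X] [IsTopologicalAddGroup X]
    {o : ℤ → X} (ho : Summable o) {e : Set X} (he : e ∈ 𝓝 0) :
    ∃ M : ℕ, ∀ F : Finset ℤ, (∀ d ∈ F, (M : ℤ) ≤ |d|) → ∑ d ∈ F, o d ∈ e := by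
  obtain ⟨s, hs⟩ := ho.vanishing he
  refine ⟨(∑ d ∈ s, d.natAbs) + 1, fun F hF => hs F (Finset.disjoint_left.2 fun d hd hds => ?_)⟩
  have h1 := hF d hd
  have h2 := Finset.single_le_sum (f := Int.natAbs) (fun _ _ => Nat.zero_le _) hds
  rw [Int.abs_eq_natAbs] at h1
  omega

section Biorbits

variable {X : Type*} [AddCommGroup X] [Module ℂ X]

/-- `T` has a dense set of points `f` with a summable two-sided orbit `o : ℤ → X`, where `o 0 = f`,
the negative indices carry the forward orbit, and the positive ones a chosen backward orbit. -/
def HasSummableBiorbits [TopologicalSpace X] (T : X →L[ℂ] X) : Prop :=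
  ∃ D : Set X, Dense D ∧ ∀ f ∈ D, ∃ o : ℤ → X, Summable o ∧ o 0 = f ∧ ∀ d, T (o d) = o (d - 1)

/-- The two-sided sequence with entries `a n` at `n` and `b n` at `-(n + 1)`. -/
def twoSided (a b : ℕ → X) : ℤ → X
  | Int.ofNat n => a n
  | Int.negSucc n => b n

theorem FrequentHypercyclicityCriterion.hasSummableBiorbits [TopologicalSpace X]
    [IsTopologicalAddGroup X] {T : X →L[ℂ] X}
    (h : FrequentHypercyclicityCriterion T) : HasSummableBiorbits T := by
  obtain ⟨X₀, hX₀, S, hS⟩ := h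
  refine ⟨X₀, hX₀, fun f hf => ?_⟩
  obtain ⟨hT, hSs, -⟩ := hS ⟨f, hf⟩
  have hS' : Summable fun n : ℕ => ((S^[n] ⟨f, hf⟩ : X₀) : X) :=
    (summable_nat_add_iff (f := fun n : ℕ => ((S^[n] ⟨f, hf⟩ : X₀) : X)) 1).1 hSs
  refine ⟨twoSided (fun n => ((S^[n] ⟨f, hf⟩ : X₀) : X)) (fun n => T^[n + 1] f), ?_, rfl, ?_⟩
  · refine (Summable.int_rec hS' hT).congr ?_
    rintro (n | n) <;> rfl
  · rintro ((_ | n) | n)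
    · rfl
    · rw [show (Int.ofNat (n + 1) - 1 : ℤ) = Int.ofNat n by simp]
      simp only [twoSided, Function.iterate_succ_apply' S]
      exact (hS _).2.2
    · rw [show (Int.negSucc n - 1 : ℤ) = Int.negSucc (n + 1) by omega]
      simp only [twoSided]
      exact (Function.iterate_succ_apply' T (n + 1) f).symm

theorem iterate_biorbit [TopologicalSpace X] {T : X →L[ℂ] X} {o : ℤ → X}
    (ho : ∀ d, T (o d) = o (d - 1)) (n : ℕ) (d : ℤ) : T^[n] (o d) = o (d - n) := by
  induction n with
  | zero => simp
  | succ n ih =>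
    rw [Function.iterate_succ_apply', ih, ho]
    congr 1
    push_cast
    ring

/-- `a 0 + b n` is close to `a 0`, and its image `a (-n) + b 0` under `Tⁿ` is close to `b 0`. -/
theorem HasSummableBiorbits.mixing [TopologicalSpace X] [IsTopologicalAddGroup X] {T : X →L[ℂ] X}
    (h : HasSummableBiorbits T) : Mixing T := by
  obtain ⟨D, hD, h⟩ := h
  intro U V hU hV hUn hVn
  obtain ⟨f, hfU, hfD⟩ := hD.inter_open_nonempty U hU hUn
  obtain ⟨g, hgV, hgD⟩ := hD.inter_open_nonempty V hV hVn
  obtain ⟨a, ha, rfl, haT⟩ := h f hfD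
  obtain ⟨b, hb, rfl, hbT⟩ := h g hgD
  have hcof : Tendsto (fun n : ℕ => (n : ℤ)) atTop cofinite := by
    rw [← Nat.cofinite_eq_atTop]
    exact Nat.cast_injective.tendsto_cofinite
  have hcof' : Tendsto (fun n : ℕ => (0 - n : ℤ)) atTop cofinite := by
    rw [← Nat.cofinite_eq_atTop]
    exact Function.Injective.tendsto_cofinite fun m n h => by simpa using h
  have h1 : Tendsto (fun n : ℕ => a 0 + b n) atTop (𝓝 (a 0)) := by
    simpa using (hb.tendsto_cofinite_zero.comp hcof).const_add (a 0)
  have h2 : Tendsto (fun n : ℕ => a (0 - n) + b 0) atTop (𝓝 (b 0)) := by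
    simpa using (ha.tendsto_cofinite_zero.comp hcof').add_const (b 0)
  obtain ⟨n, hn⟩ := eventually_atTop.1 ((h1.eventually (hU.mem_nhds hfU)).and
    (h2.eventually (hV.mem_nhds hgV)))
  refine ⟨n, fun k hk => ⟨_, ⟨_, (hn k hk).1, ?_⟩, (hn k hk).2⟩⟩
  rw [iterate_map_add, iterate_biorbit haT, iterate_biorbit hbT, sub_self]

theorem Mixing.transitive [TopologicalSpace X] {T : X →L[ℂ] X} (h : Mixing T) : Transitive T :=
  fun U V hU hV hUn hVn => (h U V hU hV hUn hVn).imp fun n hn => hn n le_rfl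

theorem hasSum_iterate [TopologicalSpace X] {ι : Type*} (T : X →L[ℂ] X) (n : ℕ) {c : ι → X} {s : X}
    (h : HasSum c s) : HasSum (fun i => T^[n] (c i)) (T^[n] s) := by
  induction n with
  | zero => simpa using h
  | succ n ih => simpa only [Function.iterate_succ_apply'] using T.hasSum ih

end Biorbits

section Complete

variable {X : Type*} [AddCommGroup X] [Module ℂ X]
variable [UniformSpace X] [IsUniformAddGroup X] [CompleteSpace X]

/-- The periodic points near `f = o 0` are the sums `∑ⱼ o (jN)` with `N` large. -/
theorem HasSummableBiorbits.chaotic [T2Space X] {T : X →L[ℂ] X}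
    (h : HasSummableBiorbits T) : Chaotic T := by
  refine ⟨h.mixing.transitive, ?_⟩
  obtain ⟨D, hD, h⟩ := h
  refine dense_iff_inter_open.2 fun U hU hUn => ?_
  obtain ⟨f, hfU, hfD⟩ := hD.inter_open_nonempty U hU hUn
  obtain ⟨o, ho, rfl, hoT⟩ := h f hfD
  have hW : (fun x => x + o 0) ⁻¹' U ∈ 𝓝 (0 : X) :=
    (continuous_add_const (o 0)).continuousAt.preimage_mem_nhds (by simpa using hU.mem_nhds hfU)
  obtain ⟨V, hV, hVW⟩ := exists_nhds_zero_half hW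
  obtain ⟨M, hM⟩ := exists_forall_finset_sum_mem ho hV
  set N : ℤ := M + 1 with hN
  have hinj : Function.Injective fun j : ℤ => j * N := mul_left_injective₀ (by omega)
  have hsum : Summable fun j : ℤ => o (j * N) := ho.comp_injective hinj
  refine ⟨∑' j : ℤ, o (j * N), ?_, M + 1, by omega, ?_⟩
  · have := sub_mem_of_finset_sum_mem hsum.hasSum 0 hV hVW fun F hF => by
      rw [← Finset.sum_image (f := o) (g := fun j : ℤ => j * N) hinj.injOn]
      refine hM _ fun d hd => ?_
      obtain ⟨j, hj, rfl⟩ := Finset.mem_image.1 hd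
      have hj0 : j ≠ 0 := fun h => hF (h ▸ hj)
      have := Int.one_le_abs hj0
      rw [abs_mul, abs_of_nonneg (show 0 ≤ N by omega)]
      nlinarith
    simpa using this
  · rw [← (hasSum_iterate T (M + 1) hsum.hasSum).tsum_eq, ← (Equiv.addRight (1 : ℤ)).tsum_eq]
    refine tsum_congr fun j => ?_
    rw [iterate_biorbit hoT]
    congr 1
    simp only [Equiv.coe_addRight, hN]
    push_cast
    ring

/-- A dense set contains a sequence that visits every non-empty open set at arbitrarily late indices. -/
theorem _root_.Dense.exists_seq_frequently_mem {X : Type*} [TopologicalSpace X]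
    [SecondCountableTopology X] {D : Set X} (hD : Dense D) (hne : Nonempty X) :
    ∃ y : ℕ → X, (∀ l, y l ∈ D) ∧
      ∀ U : Set X, IsOpen U → U.Nonempty → ∀ L, ∃ l ≥ L, y l ∈ U := by
  obtain ⟨b, hbc, hbe, hb⟩ := TopologicalSpace.exists_countable_basis X
  obtain ⟨x⟩ := hne
  obtain ⟨B, hB, -⟩ := hb.exists_subset_of_mem_open (mem_univ x) isOpen_univ
  obtain ⟨e, he⟩ := hbc.exists_eq_range ⟨B, hB⟩
  have hmem : ∀ i, ∃ y, y ∈ e i ∩ D := fun i => by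
    have hi : e i ∈ b := he ▸ mem_range_self i
    exact hD.inter_open_nonempty _ (hb.isOpen hi) (nonempty_iff_ne_empty.2 fun h => hbe (h ▸ hi))
  choose y hy using hmem
  refine ⟨fun l => y l.unpair.1, fun l => (hy _).2, fun U hU ⟨z, hz⟩ L => ?_⟩
  obtain ⟨C, hC, -, hCU⟩ := hb.exists_subset_of_mem_open hz hU
  obtain ⟨i, rfl⟩ := he ▸ hC
  refine ⟨Nat.pair i L, Nat.right_le_pair i L, ?_⟩
  simp only [Nat.unpair_pair]
  exact hCU (hy i).1

theorem FrequentlyHypercyclic.hypercyclic {X : Type*} [AddCommMonoid X] [Module ℂ X]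
    [TopologicalSpace X] {T : X →L[ℂ] X} (h : FrequentlyHypercyclic T) : Hypercyclic T := by
  obtain ⟨f, hf⟩ := h
  refine ⟨f, dense_iff_inter_open.2 fun U hU hUn => ?_⟩
  by_contra hne
  have hempty : ∀ n, T^[n] f ∉ U := fun n hn => hne ⟨_, hn, mem_range_self n⟩
  simpa [hempty] using hf U hU hUn

theorem sum_range_mem_of_antitone_nhds {X : Type*} [AddCommGroup X] {u : ℕ → Set X}
    (h0 : ∀ n, (0 : X) ∈ u n) (hu : ∀ n, ∀ x ∈ u (n + 1), ∀ y ∈ u (n + 1), x + y ∈ u n)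
    (m a : ℕ) (x : ℕ → X) (hx : ∀ l, x l ∈ u (a + l + 1)) :
    ∑ l ∈ Finset.range m, x l ∈ u a := by
  induction m generalizing a x with
  | zero => simpa using h0 a
  | succ m ih =>
    rw [Finset.sum_range_succ']
    refine hu a _ (ih (a + 1) _ fun l => ?_) _ (hx 0)
    have := hx (l + 1)
    rwa [show a + (l + 1) + 1 = a + 1 + l + 1 by ring] at this

/-- If finite sums of entries of `o l` at indices of absolute value at least `N k`, `l ≤ k`, are
very small, then so are finite sums mixing entries of all the `o l`, provided that entries of `o l`
are only taken at indices of absolute value at least `N l`. -/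
theorem sum_biorbits_mem {X : Type*} [AddCommGroup X] {u : ℕ → Set X}
    (h0 : ∀ n, (0 : X) ∈ u n) (hanti : Antitone u)
    (hu : ∀ n, ∀ x ∈ u (n + 1), ∀ y ∈ u (n + 1), x + y ∈ u n) {o : ℕ → ℤ → X} {N : ℕ → ℕ}
    (hN : ∀ k, ∀ l ≤ k, ∀ F : Finset ℤ, (∀ d ∈ F, (N k : ℤ) ≤ |d|) →
      ∑ d ∈ F, o l d ∈ u (2 * k + 1))
    (a : ℕ) (d : ℕ → ℕ → ℤ) (hd : ∀ l, Function.Injective (d l)) (F : Finset (ℕ × ℕ))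
    (hF : ∀ i ∈ F, (N (max i.1 a) : ℤ) ≤ |d i.1 i.2|) :
    ∑ i ∈ F, o i.1 (d i.1 i.2) ∈ u a := by
  classical
  obtain ⟨m, hm⟩ : ∃ m, ∀ i ∈ F, i.1 < m :=
    ⟨(F.sup Prod.fst) + 1, fun i hi => Nat.lt_succ_of_le (Finset.le_sup (f := Prod.fst) hi)⟩
  rw [← Finset.sum_fiberwise_of_maps_to (s := F) (t := Finset.range m) (g := Prod.fst)
    fun i hi => Finset.mem_range.2 (hm i hi)]
  refine sum_range_mem_of_antitone_nhds h0 hu m a _ fun l => ?_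
  refine hanti (show a + l + 1 ≤ 2 * max l a + 1 by omega) ?_
  have hinj : Set.InjOn (fun i : ℕ × ℕ => d i.1 i.2) (F.filter fun i => i.1 = l) := by
    rintro ⟨i, j⟩ hi ⟨i', j'⟩ hi' h
    obtain rfl : i = l := (Finset.mem_filter.1 hi).2
    obtain rfl : i' = i := (Finset.mem_filter.1 hi').2
    exact congrArg (Prod.mk i') (hd i' h)
  have hsum : ∑ i ∈ F with i.1 = l, o i.1 (d i.1 i.2)
      = ∑ e ∈ (F.filter fun i => i.1 = l).image fun i => d i.1 i.2, o l e := by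
    rw [Finset.sum_image hinj]
    exact Finset.sum_congr rfl fun i hi => by rw [(Finset.mem_filter.1 hi).2]
  rw [hsum]
  refine hN _ l (le_max_left _ _) _ fun e he => ?_
  obtain ⟨i, hi, rfl⟩ := Finset.mem_image.1 he
  obtain ⟨hiF, rfl⟩ := Finset.mem_filter.1 hi
  exact hF i hiF

/-- The frequently hypercyclic vector is `x = ∑ₗ ∑ₙ o l n`, where `n` runs over the `l`-th of a
sequence of widely separated sets of times of positive lower density. At such a time `n`, `Tⁿ x`
is close to `o l 0`, and the points `o l 0` are dense. -/
theorem HasSummableBiorbits.frequentlyHypercyclic [T2Space X] [SecondCountableTopology X]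
    {T : X →L[ℂ] X} (h : HasSummableBiorbits T) : FrequentlyHypercyclic T := by
  obtain ⟨D, hD, h⟩ := h
  obtain ⟨y, hyD, hy⟩ := hD.exists_seq_frequently_mem ⟨0⟩
  choose o ho ho0 hoT using fun l => h (y l) (hyD l)
  obtain ⟨u, hub, hu⟩ := IsTopologicalAddGroup.exists_antitone_basis_nhds_zero X
  have h0 : ∀ n, (0 : X) ∈ u n := fun n => mem_of_mem_nhds (hub.mem n)
  have hanti : Antitone u := hub.antitone
  replace hu : ∀ n, ∀ x ∈ u (n + 1), ∀ y ∈ u (n + 1), x + y ∈ u n := fun n x hx y hy =>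
    hu n (Set.add_mem_add hx hy)
  obtain ⟨N, hNmono, hN⟩ : ∃ N : ℕ → ℕ, StrictMono N ∧ ∀ k, ∀ l ≤ k, ∀ F : Finset ℤ,
      (∀ d ∈ F, (N k : ℤ) ≤ |d|) → ∑ d ∈ F, o l d ∈ u (2 * k + 1) := by
    refine extraction_forall_of_eventually' (P := fun k n => ∀ l ≤ k, ∀ F : Finset ℤ,
      (∀ d ∈ F, (n : ℤ) ≤ |d|) → ∑ d ∈ F, o l d ∈ u (2 * k + 1)) fun k => ?_
    choose M hM using fun l => exists_forall_finset_sum_mem (ho l) (hub.mem (2 * k + 1))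
    refine ⟨∑ l ∈ Finset.range (k + 1), M l, fun m hm l hl F hF => hM l F fun d hd => ?_⟩
    refine le_trans ?_ (hF d hd)
    have := Finset.single_le_sum (f := M) (fun _ _ => Nat.zero_le _)
      (Finset.mem_range.2 (Nat.lt_succ_of_le hl))
    exact_mod_cast this.trans hm
  obtain ⟨τ, hτ1, hτ2, hτ3⟩ := exists_separated_times
  have hgap : ∀ l j k m, (l, j) ≠ (k, m) →
      (N (max l k) : ℤ) < |(τ (N l) j : ℤ) - τ (N k) m| := by
    intro l j k m hne
    refine lt_of_le_of_lt ?_ (hτ2 (N l) j (N k) m fun h => hne ?_)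
    · rcases max_cases l k with ⟨h, -⟩ | ⟨h, -⟩ <;> rw [h] <;> push_cast <;> omega
    · rw [Prod.mk.injEq] at h ⊢
      exact ⟨hNmono.injective h.1, h.2⟩
  have hinj : Function.Injective fun i : ℕ × ℕ => τ (N i.1) i.2 := by
    rintro ⟨l, j⟩ ⟨k, m⟩ h
    by_contra hne
    have := hgap l j k m hne
    simp only at h
    rw [h, sub_self, abs_zero] at this
    omega
  have hinjl : ∀ l, Function.Injective fun j => (τ (N l) j : ℤ) := fun l j m h => by
    have := @hinj (l, j) (l, m) (by simpa using h)
    simpa using this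
  have hx : Summable fun i : ℕ × ℕ => o i.1 (τ (N i.1) i.2) := by
    refine summable_iff_vanishing.2 fun e he => ?_
    obtain ⟨a, -, ha⟩ := hub.1.mem_iff.1 he
    have hfin : {i : ℕ × ℕ | τ (N i.1) i.2 < N a}.Finite :=
      (finite_lt_nat (N a)).preimage hinj.injOn
    refine ⟨hfin.toFinset, fun F hF => ha ?_⟩
    refine sum_biorbits_mem h0 hanti hu hN a (fun l j => τ (N l) j) hinjl F fun i hi => ?_
    have h1 : N a ≤ τ (N i.1) i.2 := by
      by_contra hlt
      exact Finset.disjoint_left.1 hF hi (hfin.mem_toFinset.2 (not_le.1 hlt))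
    rw [Nat.abs_cast, Nat.cast_le]
    rcases max_cases i.1 a with ⟨h, -⟩ | ⟨h, -⟩ <;> rw [h]
    exacts [hτ1 _ _, h1]
  refine ⟨∑' i : ℕ × ℕ, o i.1 (τ (N i.1) i.2), fun U hU hUn => ?_⟩
  have key : ∀ l j, T^[τ (N (l + 1)) j] (∑' i : ℕ × ℕ, o i.1 (τ (N i.1) i.2)) - y (l + 1) ∈ u l := by
    intro l j
    have hs := hasSum_iterate T (τ (N (l + 1)) j) hx.hasSum
    simp only [fun k => iterate_biorbit (hoT k)] at hs
    have := sub_mem_of_finset_sum_mem hs (l + 1, j) (hub.mem (l + 1)) (hu l) fun F hF => ?_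
    · simpa [ho0] using this
    · refine sum_biorbits_mem h0 hanti hu hN (l + 1)
        (fun k m => (τ (N k) m : ℤ) - τ (N (l + 1)) j)
        (fun k m m' h => hinjl k (by simpa using h)) F fun i hi => ?_
      exact (hgap i.1 i.2 (l + 1) j fun h => hF (h ▸ hi)).le
  obtain ⟨z, hz⟩ := hUn
  have hzU : (fun x => x + z) ⁻¹' U ∈ 𝓝 (0 : X) :=
    (continuous_add_const z).continuousAt.preimage_mem_nhds (by simpa using hU.mem_nhds hz)
  obtain ⟨a, -, ha⟩ := hub.1.mem_iff.1 hzU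
  obtain ⟨l, hl, hyl⟩ := hy ((fun x => x - z) ⁻¹' interior (u (a + 1)))
    (isOpen_interior.preimage (by fun_prop))
    ⟨z, by simpa using mem_interior_iff_mem_nhds.2 (hub.mem (a + 1))⟩ (a + 2)
  obtain ⟨l, rfl⟩ : ∃ l', l = l' + 1 := ⟨l - 1, by omega⟩
  refine liminf_ncard_pos (A := {n | T^[n] (∑' i : ℕ × ℕ, o i.1 (τ (N i.1) i.2)) ∈ U})
    (fun j m h => hinjl (l + 1) (by simpa using h)) (hτ3 (N (l + 1))) fun j => ?_
  have := ha (hu a _ (hanti (show a + 1 ≤ l by omega) (key l j)) _ (interior_subset hyl))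
  simpa using this

end Complete

/-! ### Functionals on spaces with a hypercyclic operator -/

section Functionals

variable {X : Type*} [AddCommMonoid X] [Module ℂ X] [TopologicalSpace X] {T : X →L[ℂ] X}

/-- A continuous functional bounded on every orbit is bounded on a dense orbit, hence everywhere. -/
theorem Hypercyclic.eq_zero_of_bounded (h : Hypercyclic T) (L : X →ₗ[ℂ] ℂ) (hL : Continuous L)
    (hb : ∀ f, ∃ C, ∀ n, ‖L (T^[n] f)‖ ≤ C) : L = 0 := by
  obtain ⟨f, hf⟩ := h
  obtain ⟨C, hC⟩ := hb f
  have hall : ∀ x, ‖L x‖ ≤ C := fun x =>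
    isClosed_property hf (isClosed_le hL.norm continuous_const) hC x
  ext x
  by_contra hx
  obtain ⟨n, hn⟩ := exists_nat_gt (C / ‖L x‖)
  have h1 := hall ((n : ℂ) • x)
  rw [map_smul, smul_eq_mul, norm_mul, Complex.norm_natCast] at h1
  rw [div_lt_iff₀ (norm_pos_iff.2 hx)] at hn
  linarith

theorem Hypercyclic.eq_zero_of_comp_eq_zero (h : Hypercyclic T) (L : X →ₗ[ℂ] ℂ)
    (hL : Continuous L) (h0 : ∀ f, L (T f) = 0) : L = 0 :=
  h.eq_zero_of_bounded L hL fun f => ⟨‖L f‖, fun n => by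
    cases n with
    | zero => simp
    | succ n => simp [Function.iterate_succ_apply', h0]⟩

/-- The adjoint of a hypercyclic operator has no eigenvectors. -/
theorem Hypercyclic.eq_zero_of_comp_eq_smul (h : Hypercyclic T) (L : X →ₗ[ℂ] ℂ)
    (hL : Continuous L) {c : ℂ} (hc : ∀ f, L (T f) = c * L f) : L = 0 := by
  have hpow : ∀ f n, L (T^[n] f) = c ^ n * L f := fun f n => by
    induction n with
    | zero => simp
    | succ n ih => rw [Function.iterate_succ_apply', hc, ih, pow_succ']; ring
  rcases le_or_gt ‖c‖ 1 with h1 | h1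
  · refine h.eq_zero_of_bounded L hL fun f => ⟨‖L f‖, fun n => ?_⟩
    rw [hpow, norm_mul, norm_pow]
    exact mul_le_of_le_one_left (norm_nonneg _) (pow_le_one₀ (norm_nonneg _) h1)
  · obtain ⟨f, hf⟩ := h
    have hall : ∀ x, ‖L f‖ ≤ ‖L x‖ := fun x =>
      isClosed_property hf (isClosed_le continuous_const hL.norm) (fun n => by
        simp only [hpow, norm_mul, norm_pow]
        exact le_mul_of_one_le_left (norm_nonneg _) (one_le_pow₀ h1.le)) x
    have h0 : L f = 0 := by simpa using hall 0
    ext x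
    exact isClosed_property hf (isClosed_eq hL continuous_const) (fun n => by simp [hpow, h0]) x

end Functionals

end LinDyn

/-! ### The space `H(Ω)` -/

instance : LocallyCompactSpace puncturedDisc := isOpen_puncturedDisc.locallyCompactSpace

theorem ContinuousMap.isUniformAddGroup_complex (Y : Type*) [TopologicalSpace Y] :
    IsUniformAddGroup C(Y, ℂ) :=
  ContinuousMap.isUniformEmbedding_toUniformOnFunIsCompact.isUniformInducing.isUniformAddGroup
    (⟨⟨ContinuousMap.toUniformOnFunIsCompact, rfl⟩, fun _ _ => rfl⟩ :
      C(Y, ℂ) →+ UniformOnFun Y ℂ {K | IsCompact K})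

namespace HolSpace

variable {Ω : Set ℂ}

/-- The element of `H(Ω)` given by a function `F : ℂ → ℂ` holomorphic on `Ω`. -/
def ofDiff (F : ℂ → ℂ) (hF : DifferentiableOn ℂ F Ω) : HolSpace Ω :=
  ⟨⟨fun z : Ω => F z, continuousOn_iff_continuous_domRestrict.1 hF.continuousOn⟩, F, hF, fun _ => rfl⟩

open Classical in
/-- The extension by zero of `f ∈ H(Ω)` to the plane. -/
noncomputable def toFun (f : HolSpace Ω) (z : ℂ) : ℂ :=
  if h : z ∈ Ω then f.1 ⟨z, h⟩ else 0

theorem toFun_coe (f : HolSpace Ω) (z : Ω) : toFun f z = f.1 z := by simp [toFun]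

theorem toFun_ofDiff {F : ℂ → ℂ} (hF : DifferentiableOn ℂ F Ω) {z : ℂ} (hz : z ∈ Ω) :
    toFun (ofDiff F hF) z = F z :=
  toFun_coe (ofDiff F hF) ⟨z, hz⟩

theorem differentiableOn_toFun (f : HolSpace Ω) : DifferentiableOn ℂ (toFun f) Ω := by
  obtain ⟨F, hF, hf⟩ := f.2
  exact hF.congr fun z hz => by rw [← hf ⟨z, hz⟩, ← toFun_coe]

theorem ext_toFun {f g : HolSpace Ω} (h : ∀ z ∈ Ω, toFun f z = toFun g z) : f = g :=
  Subtype.ext <| ContinuousMap.ext fun z => by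
    rw [← toFun_coe, ← toFun_coe, h z z.2]

theorem toFun_add (f g : HolSpace Ω) (z : ℂ) : toFun (f + g) z = toFun f z + toFun g z := by
  by_cases hz : z ∈ Ω <;> simp [toFun, hz]

theorem toFun_smul (c : ℂ) (f : HolSpace Ω) (z : ℂ) : toFun (c • f) z = c * toFun f z := by
  by_cases hz : z ∈ Ω <;> simp [toFun, hz]

theorem toFun_zero (z : ℂ) : toFun (0 : HolSpace Ω) z = 0 := by
  by_cases hz : z ∈ Ω <;> simp [toFun, hz]

theorem toFun_weightedComp (hΩ : IsOpen Ω) {ω ψ : ℂ → ℂ} (hω : DifferentiableOn ℂ ω Ω)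
    (hψ : DifferentiableOn ℂ ψ Ω) (hm : MapsTo ψ Ω Ω) (f : HolSpace Ω) {z : ℂ} (hz : z ∈ Ω) :
    toFun (weightedComp Ω hΩ ω ψ hω hψ hm f) z = ω z * toFun f (ψ z) := by
  rw [toFun_coe (weightedComp Ω hΩ ω ψ hω hψ hm f) ⟨z, hz⟩, toFun_coe f ⟨ψ z, hm hz⟩]
  rfl

instance : IsUniformAddGroup (HolSpace Ω) :=
  have := ContinuousMap.isUniformAddGroup_complex Ω
  inferInstanceAs (IsUniformAddGroup (HolSpace Ω).toAddSubgroup)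

instance : ContinuousAdd (HolSpace Ω) :=
  AddSubmonoid.continuousAdd (HolSpace Ω).toAddSubmonoid

/-- The Weierstrass convergence theorem. -/
theorem isClosed (hΩ : IsOpen Ω) : IsClosed (HolSpace Ω : Set C(Ω, ℂ)) := by
  have : LocallyCompactSpace Ω := hΩ.locallyCompactSpace
  classical
  refine isClosed_of_closure_subset fun f hf => ?_
  have hne : (𝓝 f ⊓ 𝓟 (HolSpace Ω : Set C(Ω, ℂ))).NeBot := mem_closure_iff_clusterPt.1 hf
  let e : C(Ω, ℂ) → ℂ → ℂ := fun g z => if h : z ∈ Ω then g ⟨z, h⟩ else 0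
  have he : ∀ g (z : Ω), e g z = g z := fun g z => by simp [e]
  have hlim : Tendsto (fun g : C(Ω, ℂ) => g) (𝓝 f ⊓ 𝓟 (HolSpace Ω : Set C(Ω, ℂ))) (𝓝 f) :=
    tendsto_id.mono_left inf_le_left
  rw [ContinuousMap.tendsto_iff_tendstoLocallyUniformly] at hlim
  have hlim' : TendstoLocallyUniformlyOn e (e f) (𝓝 f ⊓ 𝓟 (HolSpace Ω : Set C(Ω, ℂ))) Ω := by
    rw [tendstoLocallyUniformlyOn_iff_tendstoLocallyUniformly_comp_coe]
    convert hlim using 2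
    · funext z; exact he _ z
    · funext z; exact he f z
  refine ⟨e f, hlim'.differentiableOn ?_ hΩ, fun z => (he f z).symm⟩
  filter_upwards [mem_inf_of_right (mem_principal_self _)] with g hg
  obtain ⟨F, hF, hf⟩ := hg
  exact hF.congr fun z hz => by rw [← hf ⟨z, hz⟩, ← he]

instance : CompleteSpace (HolSpace puncturedDisc) :=
  (isClosed isOpen_puncturedDisc).completeSpace_coe

instance : SecondCountableTopology (HolSpace puncturedDisc) :=
  TopologicalSpace.Subtype.secondCountableTopology _

theorem mem_closure_of_forall_compact {S : Set (HolSpace Ω)} {f : HolSpace Ω}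
    (h : ∀ K ⊆ Ω, IsCompact K → ∀ ε > 0, ∃ s ∈ S, ∀ z ∈ K, ‖toFun f z - toFun s z‖ < ε) :
    f ∈ closure S := by
  rw [Topology.IsInducing.subtypeVal.closure_eq_preimage_closure_image, mem_preimage,
    mem_closure_iff_nhds_basis
      (nhds_basis_uniformity Metric.uniformity_basis_dist.compactConvergenceUniformity)]
  rintro ⟨K, ε⟩ ⟨hK, hε⟩
  obtain ⟨s, hs, hle⟩ := h ((↑) '' K) (by rintro _ ⟨z, -, rfl⟩; exact z.2)
    (hK.image continuous_subtype_val) ε hε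
  refine ⟨s, mem_image_of_mem _ hs, fun z hz => ?_⟩
  have := hle z (mem_image_of_mem _ hz)
  rw [toFun_coe, toFun_coe, ← dist_eq_norm, dist_comm] at this
  exact this

theorem summable_of_norm_le {F : ℕ → HolSpace puncturedDisc}
    (h : ∀ K ⊆ puncturedDisc, IsCompact K → ∃ b : ℕ → ℝ, Summable b ∧
      ∀ k, ∀ z ∈ K, ‖toFun (F k) z‖ ≤ b k) : Summable F := by
  have hs : Summable fun k => (F k : C(puncturedDisc, ℂ)) := by
    refine ContinuousMap.summable_of_locally_summable_norm fun K => ?_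
    obtain ⟨b, hb, hle⟩ := h ((↑) '' (K : Set puncturedDisc)) (by rintro _ ⟨z, -, rfl⟩; exact z.2)
      (K.isCompact.image continuous_subtype_val)
    refine Summable.of_nonneg_of_le (fun _ => norm_nonneg _)
      (fun k => (?_ : _ ≤ |b k|)) hb.abs
    refine (ContinuousMap.norm_le _ (abs_nonneg _)).2 fun z => ?_
    have := hle k z ⟨z, z.2, rfl⟩
    rw [toFun_coe] at this
    exact this.trans (le_abs_self _)
  have hmem : ∑' k, (F k : C(puncturedDisc, ℂ)) ∈ HolSpace puncturedDisc :=
    (isClosed isOpen_puncturedDisc).mem_of_tendsto hs.hasSum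
      (Eventually.of_forall fun s => Submodule.sum_mem _ fun k _ => (F k).2)
  exact ⟨⟨_, hmem⟩, (Topology.IsInducing.subtypeVal.hasSum_iff
    (g := (HolSpace puncturedDisc).subtype) F ⟨_, hmem⟩).1 hs.hasSum⟩

theorem continuous_toFun {z : ℂ} (hz : z ∈ Ω) : Continuous fun f : HolSpace Ω => toFun f z := by
  have : (fun f : HolSpace Ω => toFun f z) = fun f => f.1 ⟨z, hz⟩ := by
    funext f; exact toFun_coe f ⟨z, hz⟩
  rw [this]
  exact (continuous_eval_const _).comp continuous_subtype_val

theorem continuous_circleIntegral (hΩ : IsOpen Ω) {γ : ℝ → ℂ} (hγ : Continuous γ) (hγm : ∀ θ, γ θ ∈ Ω)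
    {k : ℝ → ℂ} (hk : Continuous k) (a b : ℝ) :
    Continuous fun f : HolSpace Ω => ∫ θ in a..b, k θ * toFun f (γ θ) := by
  have : LocallyCompactSpace Ω := hΩ.locallyCompactSpace
  refine intervalIntegral.continuous_parametric_intervalIntegral_of_continuous' ?_ _ _
  have : Function.uncurry (fun (f : HolSpace Ω) (θ : ℝ) => k θ * toFun f (γ θ)) =
      fun p : HolSpace Ω × ℝ => k p.2 * p.1.1 ⟨γ p.2, hγm p.2⟩ := by
    funext p
    simp only [Function.uncurry]
    rw [← toFun_coe]
  rw [this]
  refine (hk.comp continuous_snd).mul ?_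
  exact (continuous_subtype_val.comp continuous_fst).eval
    ((hγ.subtype_mk hγm).comp continuous_snd)

end HolSpace

/-! ### Logarithms, Laurent splitting and injective holomorphic functions -/

theorem norm_lt_one_of_mem_puncturedDisc {z : ℂ} (hz : z ∈ puncturedDisc) : ‖z‖ < 1 := by
  simpa using hz.1

theorem ne_zero_of_mem_puncturedDisc {z : ℂ} (hz : z ∈ puncturedDisc) : z ≠ 0 := hz.2

theorem mem_puncturedDisc {z : ℂ} : z ∈ puncturedDisc ↔ ‖z‖ < 1 ∧ z ≠ 0 := by
  simp [puncturedDisc]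

/-- An annulus is the image of a vertical strip under `exp`. The condition `z ≠ 0` only matters for
`a < 0`, where the set is a punctured disc. -/
theorem isPreconnected_annulus (a b : ℝ) : IsPreconnected {z : ℂ | a < ‖z‖ ∧ ‖z‖ < b ∧ z ≠ 0} := by
  have h : {z : ℂ | a < ‖z‖ ∧ ‖z‖ < b ∧ z ≠ 0} =
      Complex.exp '' (Complex.re ⁻¹' {x | a < Real.exp x ∧ Real.exp x < b}) := by
    ext z
    constructor
    · rintro ⟨h1, h2, h3⟩
      refine ⟨Complex.log z, ?_, Complex.exp_log h3⟩
      simpa [Complex.log_re, Real.exp_log (norm_pos_iff.2 h3)] using And.intro h1 h2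
    · rintro ⟨s, hs, rfl⟩
      simpa [Complex.norm_exp] using hs
  have hconv : Convex ℝ {x : ℝ | a < Real.exp x ∧ Real.exp x < b} := by
    refine Set.OrdConnected.convex ⟨fun x hx y hy z hz => ⟨?_, ?_⟩⟩
    · exact hx.1.trans_le (Real.exp_le_exp.2 hz.1)
    · exact (Real.exp_le_exp.2 hz.2).trans_lt hy.2
  rw [h]
  exact ((hconv.is_linear_preimage Complex.reLm.isLinear).isPreconnected).image _
    Complex.continuous_exp.continuousOn

theorem isPreconnected_puncturedDisc : IsPreconnected puncturedDisc := by
  convert isPreconnected_annulus (-1) 1 using 1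
  ext z
  rw [mem_puncturedDisc]
  exact ⟨fun h => ⟨by linarith [norm_nonneg z], h.1, h.2⟩, fun h => h.2⟩

/-- A primitive of the logarithmic derivative is a logarithm up to a constant. -/
theorem eq_mul_exp_of_logDeriv_primitive {U : Set ℂ} (hU : IsOpen U) (hc : IsPreconnected U)
    {f g : ℂ → ℂ} (hf : DifferentiableOn ℂ f U) (h0 : ∀ z ∈ U, f z ≠ 0)
    (hg : ∀ z ∈ U, HasDerivAt g (deriv f z / f z) z) {z₀ z : ℂ} (hz₀ : z₀ ∈ U) (hz : z ∈ U) :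
    f z = f z₀ * Complex.exp (g z - g z₀) := by
  have hder : ∀ x ∈ U, HasDerivAt (fun x => f x * Complex.exp (-g x)) 0 x := fun x hx => by
    have h1 := (hf.hasDerivAt (hU.mem_nhds hx)).fun_mul (hg x hx).fun_neg.cexp
    refine h1.congr_deriv ?_
    have := h0 x hx
    field_simp
    ring
  obtain ⟨a, ha⟩ := hU.exists_is_const_of_deriv_eq_zero hc
    (fun x hx => (hder x hx).differentiableAt.differentiableWithinAt)
    fun x hx => (hder x hx).deriv
  have h1 := ha z hz
  have h2 := ha z₀ hz₀
  rw [← h2] at h1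
  simp only [Complex.exp_neg] at h1
  rw [Complex.exp_sub]
  field_simp at h1 ⊢
  exact h1

theorem exists_eq_exp_of_ball {c : ℂ} {r : ℝ} (hr : 0 < r) {f : ℂ → ℂ}
    (hf : DifferentiableOn ℂ f (Metric.ball c r)) (h0 : ∀ z ∈ Metric.ball c r, f z ≠ 0) :
    ∃ g, DifferentiableOn ℂ g (Metric.ball c r) ∧ ∀ z ∈ Metric.ball c r, f z = Complex.exp (g z) := by
  obtain ⟨g, hgc, hg⟩ := ((hf.deriv Metric.isOpen_ball).div hf h0).isExactOn_ball.with_val_at c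
    (Complex.log (f c))
  have hc : c ∈ Metric.ball c r := Metric.mem_ball_self hr
  refine ⟨g, fun z hz => (hg z hz).differentiableAt.differentiableWithinAt, fun z hz => ?_⟩
  rw [eq_mul_exp_of_logDeriv_primitive Metric.isOpen_ball Metric.isPreconnected_ball hf h0 hg hc hz,
    Complex.exp_sub, hgc, Complex.exp_log (h0 c hc), mul_div_cancel₀ _ (h0 c hc)]

/-- Removability of a singularity. The extension agrees with `g` at every `z ≠ 0`, also outside the
disc. -/
theorem exists_extension_of_bounded {R r C : ℝ} (hr : 0 < r) {g : ℂ → ℂ} (hR : 0 < R)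
    (hg : DifferentiableOn ℂ g (Metric.ball 0 R \ {0}))
    (hb : ∀ z, z ≠ 0 → ‖z‖ < r → ‖g z‖ ≤ C) :
    ∃ P, DifferentiableOn ℂ P (Metric.ball 0 R) ∧ ∀ z, z ≠ 0 → P z = g z := by
  refine ⟨_, Complex.differentiableOn_update_limUnder_of_isLittleO (Metric.ball_mem_nhds 0 hR) hg
    (IsBoundedUnder.isLittleO_sub_self_inv ⟨C + ‖g 0‖, ?_⟩),
    fun z hz => Function.update_of_ne hz _ _⟩
  rw [eventually_map, eventually_nhdsWithin_iff]
  filter_upwards [Metric.ball_mem_nhds (0 : ℂ) hr] with z hz hz0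
  exact norm_sub_le_of_le (hb z hz0 (by simpa using hz)) le_rfl

/-- A function holomorphic near infinity is the sum of an entire function and a function bounded
near infinity. -/
theorem exists_entire_sub_bounded {a : ℝ} (ha : 0 < a) {F : ℂ → ℂ}
    (hF : DifferentiableOn ℂ F {t | a < ‖t‖}) :
    ∃ E : ℂ → ℂ, Differentiable ℂ E ∧ ∃ b C : ℝ, 0 < b ∧ ∀ t, b < ‖t‖ → ‖F t - E t‖ ≤ C := by
  have hopen : IsOpen {t : ℂ | a < ‖t‖} := isOpen_lt continuous_const continuous_norm
  set b := a + 1 with hb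
  let J : ℝ → ℂ → ℂ := fun ρ t => (2 * Real.pi * Complex.I : ℂ)⁻¹ • ∮ η in C(0, ρ), (η - t)⁻¹ • F η
  have hcont : ∀ ρ, a < ρ → ContinuousOn F (Metric.sphere 0 ρ) := fun ρ hρ =>
    hF.continuousOn.mono fun z hz => by
      rw [mem_sphere_zero_iff_norm] at hz
      simpa [hz] using hρ
  have hJ : ∀ ρ ρ' t, b ≤ ρ → ρ ≤ ρ' → ‖t‖ < ρ → J ρ' t = J ρ t := by
    intro ρ ρ' t h1 h2 h3
    have hd : ∀ z : ℂ, ρ ≤ ‖z‖ → DifferentiableAt ℂ (fun η => (η - t)⁻¹ • F η) z := fun z hz => by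
      have hne : z - t ≠ 0 := fun h => by rw [sub_eq_zero.1 h] at hz; linarith
      exact ((differentiableAt_id.sub_const t).inv hne).smul
        (hF.differentiableAt (hopen.mem_nhds (by simp only [mem_ofPred_eq]; linarith)))
    simp only [J]
    rw [Complex.circleIntegral_eq_of_differentiable_on_annulus_off_countable
      (by linarith) h2 countable_empty]
    · exact fun z hz => (hd z (by simpa using hz.2)).continuousAt.continuousWithinAt
    · exact fun z hz => hd z (by simpa using (not_le.1 (by simpa using hz.1.2)).le)
  refine ⟨fun t => J (‖t‖ + b) t, fun t₀ => ?_, ?_⟩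
  · have hρ : 0 < ‖t₀‖ + 1 + b := by positivity
    have hρ' : ((‖t₀‖ + 1 + b).toNNReal : ℝ) = ‖t₀‖ + 1 + b := Real.coe_toNNReal _ hρ.le
    have hps := hasFPowerSeriesOn_cauchy_integral (R := (‖t₀‖ + 1 + b).toNNReal) (c := 0) (f := F)
      (by
        rw [hρ']
        exact (hcont _ (by linarith [norm_nonneg t₀])).circleIntegrable hρ.le)
      (Real.toNNReal_pos.2 hρ)
    rw [hρ'] at hps
    have hd : DifferentiableAt ℂ (J (‖t₀‖ + 1 + b)) t₀ := by
      refine hps.differentiableOn.differentiableAt (Metric.isOpen_eball.mem_nhds ?_)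
      rw [Metric.eball_coe, mem_ball_zero_iff, hρ']
      linarith
    refine hd.congr_of_eventuallyEq ?_
    filter_upwards [Metric.ball_mem_nhds t₀ one_pos] with t ht
    have h1 : ‖t‖ ≤ ‖t₀‖ + 1 := by
      have := norm_sub_norm_le t t₀
      rw [mem_ball_iff_norm] at ht
      linarith
    exact (hJ _ _ t (by linarith [norm_nonneg t]) (by linarith) (by linarith)).symm
  · obtain ⟨M, hM⟩ := (isCompact_sphere (0 : ℂ) b).exists_bound_of_continuousOn (hcont b (by linarith))
    refine ⟨b + 1, b * M, by linarith, fun t ht => ?_⟩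
    have hta : a < ‖t‖ := by linarith
    have hds : DifferentiableOn ℂ (dslope F t) {t | a < ‖t‖} :=
      (Complex.differentiableOn_dslope (hopen.mem_nhds hta)).2 hF
    have hρ : 0 < ‖t‖ + b := by linarith
    have hint : ∀ ρ, a < ρ → ‖t‖ ≠ ρ → (∮ η in C(0, ρ), dslope F t η) =
        (∮ η in C(0, ρ), (η - t)⁻¹ • F η) - (∮ η in C(0, ρ), (η - t)⁻¹) • F t := by
      intro ρ hρ hne
      have hρ0 : 0 ≤ ρ := by linarith
      have hsub : ∀ η ∈ Metric.sphere (0 : ℂ) ρ, η - t ≠ 0 := fun η hη h => by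
        rw [mem_sphere_zero_iff_norm, sub_eq_zero.1 h] at hη
        exact hne hη
      have hinv : ContinuousOn (fun η : ℂ => (η - t)⁻¹) (Metric.sphere 0 ρ) :=
        (continuousOn_id.sub continuousOn_const).inv₀ hsub
      rw [← circleIntegral.integral_smul_const, ← circleIntegral.integral_sub
        (f := fun η => (η - t)⁻¹ • F η) (g := fun η => (η - t)⁻¹ • F t)
        ((hinv.smul (hcont ρ hρ)).circleIntegrable hρ0)
        ((hinv.smul continuousOn_const).circleIntegrable hρ0)]
      refine circleIntegral.integral_congr hρ0 fun η hη => ?_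
      rw [dslope_of_ne _ (sub_ne_zero.1 (hsub η hη)), slope_def_module, smul_sub]
    have heq : (∮ η in C(0, ‖t‖ + b), dslope F t η) = ∮ η in C(0, b), dslope F t η :=
      Complex.circleIntegral_eq_of_differentiable_on_annulus_off_countable
        (by linarith) (by linarith) countable_empty
        (hds.continuousOn.mono fun z hz => by
          have : b ≤ ‖z‖ := by simpa using hz.2
          simp only [mem_ofPred_eq]; linarith)
        fun z hz => hds.differentiableAt (hopen.mem_nhds (by
          have : b < ‖z‖ := by simpa using hz.1.2
          simp only [mem_ofPred_eq]; linarith))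
    rw [hint _ (by linarith) (by linarith), hint _ (by linarith) (by linarith),
      circleIntegral.integral_sub_inv_of_mem_ball (by simp; linarith)] at heq
    have hz : (∮ η in C(0, b), (η - t)⁻¹) = 0 := by
      refine DiffContOnCl.circleIntegral_eq_zero (by linarith) (DifferentiableOn.diffContOnCl_ball
        (U := {η | η ≠ t}) (fun η hη => ?_) fun η hη h => ?_)
      · exact ((differentiableAt_id.sub_const t).inv (sub_ne_zero.2 hη)).differentiableWithinAt
      · rw [h, mem_closedBall_zero_iff] at hη
        linarith
    rw [hz, zero_smul, sub_zero] at heq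
    have hFt : F t - J (‖t‖ + b) t = -J b t := by
      have hpi : (2 * Real.pi * Complex.I : ℂ) ≠ 0 := by simp [Real.pi_ne_zero]
      simp only [J, ← heq, smul_sub, smul_smul, inv_mul_cancel₀ hpi, one_smul]
      ring
    rw [hFt, norm_neg]
    refine circleIntegral.norm_two_pi_i_inv_smul_integral_le_of_norm_le_const (by linarith)
      fun η hη => ?_
    rw [norm_smul, norm_inv]
    have hηb := mem_sphere_zero_iff_norm.1 hη
    have h1 : 1 ≤ ‖η - t‖ := by
      have := norm_sub_norm_le t η
      rw [norm_sub_rev] at this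
      linarith
    exact (mul_le_of_le_one_left (norm_nonneg _) (inv_le_one_of_one_le₀ h1)).trans (hM η hη)

/-- The principal part of `f` at `0` is an entire function of `1 / z`. The equation for `z` outside
the disc is a statement about the junk values of `P`. -/
theorem exists_laurent_splitting {R : ℝ} (hR : 0 < R) {f : ℂ → ℂ}
    (hf : DifferentiableOn ℂ f (Metric.ball 0 R \ {0})) :
    ∃ P N : ℂ → ℂ, DifferentiableOn ℂ P (Metric.ball 0 R) ∧ Differentiable ℂ N ∧
      ∀ z, z ≠ 0 → f z = P z + N z⁻¹ := by
  have hF : DifferentiableOn ℂ (fun t => f t⁻¹) {t | R⁻¹ < ‖t‖} := by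
    refine hf.comp (g := f) (f := fun t => t⁻¹) (fun t ht => ?_) fun t ht => ?_
    · have : t ≠ 0 := norm_pos_iff.1 (lt_trans (inv_pos.2 hR) ht)
      exact (differentiableAt_inv this).differentiableWithinAt
    · have h0 : 0 < ‖t‖ := lt_trans (inv_pos.2 hR) ht
      refine ⟨?_, by simpa using norm_pos_iff.1 h0⟩
      rw [mem_ball_zero_iff, norm_inv]
      exact (inv_lt_comm₀ hR h0).1 ht
  obtain ⟨N, hN, b, C, hb, hC⟩ := exists_entire_sub_bounded (inv_pos.2 hR) hF
  obtain ⟨P, hP, hPe⟩ := exists_extension_of_bounded (r := b⁻¹) (C := C) (inv_pos.2 hb)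
    (g := fun z => f z - N z⁻¹) hR
    (hf.sub (hN.comp_differentiableOn (differentiableOn_inv.mono fun z hz => hz.2)))
    (fun z hz hzb => by
      have := hC z⁻¹ (by rw [norm_inv]; exact (lt_inv_comm₀ (norm_pos_iff.2 hz) hb).1 hzb)
      simpa using this)
  exact ⟨P, N, hP, hN, fun z hz => by rw [hPe z hz]; ring⟩

/-- The residue at `0` is the only obstruction to the existence of a primitive. -/
theorem exists_primitive_sub_residue {q : ℂ → ℂ} (hq : DifferentiableOn ℂ q puncturedDisc) :
    ∃ b : ℂ, ∃ Q : ℂ → ℂ, ∀ z ∈ puncturedDisc, HasDerivAt Q (q z - b / z) z := by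
  obtain ⟨P, N, hP, hN, hPN⟩ := exists_laurent_splitting one_pos hq
  have hds : ∀ N : ℂ → ℂ, Differentiable ℂ N → Differentiable ℂ (dslope N 0) := fun N hN => by
    rw [← differentiableOn_univ] at hN ⊢
    exact (Complex.differentiableOn_dslope univ_mem).2 hN
  obtain ⟨A, hA⟩ := hP.isExactOn_ball
  obtain ⟨B, hB⟩ := (hds _ (hds N hN)).isExactOn_univ
  have hval : ∀ N : ℂ → ℂ, ∀ t, N t = N 0 + t * dslope N 0 t := fun N t => by
    have := sub_smul_dslope N 0 t
    rw [sub_zero, smul_eq_mul] at this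
    rw [this]; ring
  refine ⟨dslope N 0 0, fun z => A z + N 0 * z - B z⁻¹, fun z hz => ?_⟩
  have hz0 := ne_zero_of_mem_puncturedDisc hz
  have h1 := ((hA z hz.1).add ((hasDerivAt_id z).const_mul (N 0))).sub
    ((hB z⁻¹ (mem_univ _)).comp z (hasDerivAt_inv hz0))
  refine h1.congr_deriv ?_
  rw [hPN z hz0, hval N z⁻¹, hval (dslope N 0) z⁻¹]
  field_simp
  ring

/-- The exponent `n`, the winding number of `ω` about `0`, is the residue of `ω' / ω`. -/
theorem exists_eq_zpow_mul_exp {ω : ℂ → ℂ} (hω : DifferentiableOn ℂ ω puncturedDisc)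
    (h0 : ∀ z ∈ puncturedDisc, ω z ≠ 0) :
    ∃ n : ℤ, ∃ W : ℂ → ℂ, DifferentiableOn ℂ W puncturedDisc ∧
      ∀ z ∈ puncturedDisc, ω z = z ^ n * Complex.exp (W z) := by
  obtain ⟨b, Q, hQ⟩ := exists_primitive_sub_residue
    (q := fun z => deriv ω z / ω z) ((hω.deriv isOpen_puncturedDisc).div hω h0)
  -- The residue `b` is an integer: pull back by `exp` to the left half-plane and use the period.
  obtain ⟨n, hn⟩ : ∃ n : ℤ, b = n := by
    let U : Set ℂ := {s | s.re < 0}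
    have hU : IsOpen U := isOpen_lt Complex.continuous_re continuous_const
    have hUc : IsPreconnected U := (convex_halfSpace_re_lt 0).isPreconnected
    have hexp : ∀ s ∈ U, Complex.exp s ∈ puncturedDisc := fun s hs => by
      rw [mem_puncturedDisc, Complex.norm_exp]
      exact ⟨Real.exp_lt_one_iff.2 hs, Complex.exp_ne_zero s⟩
    have hd : ∀ s ∈ U, HasDerivAt (fun s => ω (Complex.exp s))
        (deriv ω (Complex.exp s) * Complex.exp s) s := fun s hs =>
      (hω.hasDerivAt (isOpen_puncturedDisc.mem_nhds (hexp s hs))).comp s (Complex.hasDerivAt_exp s)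
    have key := eq_mul_exp_of_logDeriv_primitive hU hUc (f := fun s => ω (Complex.exp s))
      (g := fun s => b * s + Q (Complex.exp s))
      (fun s hs => (hd s hs).differentiableAt.differentiableWithinAt)
      (fun s hs => h0 _ (hexp s hs)) (fun s hs => by
        have h1 := ((hasDerivAt_id s).const_mul b).add
          ((hQ _ (hexp s hs)).comp s (Complex.hasDerivAt_exp s))
        refine h1.congr_deriv ?_
        rw [(hd s hs).deriv]
        have := Complex.exp_ne_zero s
        field_simp
        ring)
      (z₀ := -1) (z := -1 + 2 * Real.pi * Complex.I) (by simp [U]) (by simp [U])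
    have hper : Complex.exp (-1 + 2 * Real.pi * Complex.I) = Complex.exp (-1) := by
      rw [Complex.exp_add, Complex.exp_two_pi_mul_I, mul_one]
    simp only [hper] at key
    have hne := h0 _ (hexp (-1) (by simp [U]))
    have h1 : Complex.exp (b * (2 * Real.pi * Complex.I)) = 1 := by
      have := mul_left_cancel₀ hne ((mul_one _).trans key)
      rw [this]
      congr 1
      ring
    obtain ⟨n, hn⟩ := Complex.exp_eq_one_iff.1 h1
    exact ⟨n, mul_right_cancel₀ Complex.two_pi_I_ne_zero hn⟩
  have hz : (1 / 2 : ℂ) ∈ puncturedDisc := by rw [mem_puncturedDisc]; norm_num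
  have hf : DifferentiableOn ℂ (fun z => ω z * z ^ (-n)) puncturedDisc :=
    hω.mul fun z hz => (differentiableAt_zpow.2
      (Or.inl (ne_zero_of_mem_puncturedDisc hz))).differentiableWithinAt
  have hfd : ∀ z ∈ puncturedDisc, deriv (fun z => ω z * z ^ (-n)) z / (ω z * z ^ (-n)) =
      deriv ω z / ω z - b / z := fun z hz => by
    have hz0 := ne_zero_of_mem_puncturedDisc hz
    rw [((hω.hasDerivAt (isOpen_puncturedDisc.mem_nhds hz)).fun_mul
      (hasDerivAt_zpow (-n) z (Or.inl hz0))).deriv, hn, zpow_sub_one₀ hz0]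
    have := h0 z hz
    have h2 : z ^ (-n) ≠ 0 := zpow_ne_zero _ hz0
    push_cast
    field_simp
    ring
  have hfne : ∀ z ∈ puncturedDisc, ω z * z ^ (-n) ≠ 0 := fun z hz =>
    mul_ne_zero (h0 z hz) (zpow_ne_zero _ (ne_zero_of_mem_puncturedDisc hz))
  refine ⟨n, fun z => Complex.log (ω (1 / 2) * (1 / 2) ^ (-n)) + (Q z - Q (1 / 2)),
    fun z hz => ?_, fun z hz' => ?_⟩
  · exact ((hQ z hz).differentiableAt.sub_const _).const_add _ |>.differentiableWithinAt
  · have := eq_mul_exp_of_logDeriv_primitive isOpen_puncturedDisc isPreconnected_puncturedDisc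
      hf hfne (g := Q) (fun z hz => by rw [hfd z hz]; exact hQ z hz) hz hz'
    rw [Complex.exp_add, Complex.exp_log (hfne _ hz), ← this, zpow_neg]
    have h2 : z ^ n ≠ 0 := zpow_ne_zero _ (ne_zero_of_mem_puncturedDisc hz')
    field_simp

/-- Near a zero of order `n` of the derivative, `f` is the `(n + 1)`-st power of a local coordinate,
up to a constant, and hence not injective. -/
theorem deriv_ne_zero_of_injOn {U : Set ℂ} (hU : IsOpen U) {f : ℂ → ℂ}
    (hf : DifferentiableOn ℂ f U) (hi : InjOn f U) {z : ℂ} (hz : z ∈ U) : deriv f z ≠ 0 := by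
  intro hd
  have hfa : AnalyticAt ℂ f z := hf.analyticAt (hU.mem_nhds hz)
  have hga : AnalyticAt ℂ (fun w => f w - f z) z := hfa.fun_sub analyticAt_const
  have hne : analyticOrderAt (fun w => f w - f z) z ≠ ⊤ := by
    rw [Ne, analyticOrderAt_eq_top]
    intro h
    obtain ⟨w, ⟨hw, hwU⟩, hwz⟩ := (((h.and (hU.mem_nhds hz)).filter_mono
      nhdsWithin_le_nhds).and (self_mem_nhdsWithin (a := z) (s := {z}ᶜ))).exists
    exact hwz (hi hwU hz (sub_eq_zero.1 hw))
  obtain ⟨n, hn⟩ := ENat.ne_top_iff_exists.1 hne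
  obtain ⟨G, hG, hG0, hGe⟩ := hga.analyticOrderAt_eq_natCast.1 hn.symm
  have hn0 : n ≠ 0 := fun h => by
    have := hGe.self_of_nhds
    simp [h] at this
    exact hG0 this.symm
  have hn1 : n ≠ 1 := fun h => by
    have h1 : HasDerivAt (fun w => (w - z) ^ n • G w) (G z) z := by
      have h2 := ((hasDerivAt_id z).sub_const z).fun_mul hG.differentiableAt.hasDerivAt
      simpa [h] using h2
    have h3 : deriv (fun w => f w - f z) z = G z :=
      (h1.congr_of_eventuallyEq hGe).deriv
    rw [deriv_sub_const, hd] at h3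
    exact hG0 h3.symm
  obtain ⟨c, hc⟩ := IsAlgClosed.exists_pow_nat_eq (G z) (Nat.pos_of_ne_zero hn0)
  have hc0 : c ≠ 0 := fun h => hG0 (by rw [← hc, h, zero_pow hn0])
  set H : ℂ → ℂ := fun w => c * Complex.exp (Complex.log (G w / G z) / n) with hH
  have hHd : DifferentiableAt ℂ H z := by
    have h1 : DifferentiableAt ℂ (fun w => Complex.log (G w / G z)) z := by
      refine (hG.differentiableAt.div_const _).clog ?_
      rw [div_self hG0]
      exact Complex.one_mem_slitPlane
    exact ((h1.div_const _).cexp).const_mul c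
  have hφa : AnalyticAt ℂ (fun w => (w - z) * H w) z := by
    have hG' : AnalyticAt ℂ (fun w => G w / G z) z := hG.fun_div analyticAt_const hG0
    refine (analyticAt_id.fun_sub analyticAt_const).fun_mul (analyticAt_const.fun_mul ?_)
    refine AnalyticAt.cexp (AnalyticAt.fun_div (hG'.clog ?_) analyticAt_const (by simpa using hn0))
    rw [div_self hG0]
    exact Complex.one_mem_slitPlane
  have hφd : HasStrictDerivAt (fun w => (w - z) * H w) (H z) z := by
    have h1 := ((hasDerivAt_id' z).sub_const z).fun_mul hHd.hasDerivAt
    have h2 := hφa.hasStrictDerivAt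
    rw [h1.deriv] at h2
    simpa using h2
  have hHz : H z ≠ 0 := mul_ne_zero hc0 (Complex.exp_ne_zero _)
  have hmap := hφd.map_nhds_eq hHz
  rw [sub_self, zero_mul] at hmap
  set S : Set ℂ := {w | w ∈ U ∧ f w - f z = ((w - z) * H w) ^ n}
  have hS : S ∈ 𝓝 z := by
    filter_upwards [hU.mem_nhds hz, hGe, hG.continuousAt.eventually_ne hG0] with w hwU hw hw0
    refine ⟨hwU, ?_⟩
    rw [hw, smul_eq_mul, mul_pow, hH, mul_pow, hc, ← Complex.exp_nat_mul,
      mul_div_cancel₀ _ (by exact_mod_cast hn0), Complex.exp_log (div_ne_zero hw0 hG0),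
      mul_div_cancel₀ _ hG0]
  have hS' : (fun w => (w - z) * H w) '' S ∈ 𝓝 (0 : ℂ) := hmap ▸ image_mem_map hS
  set ζ : ℂ := Complex.exp (2 * Real.pi * Complex.I / n)
  have hζ : IsPrimitiveRoot ζ n := Complex.isPrimitiveRoot_exp n hn0
  have hζS : (fun v => ζ * v) ⁻¹' ((fun w => (w - z) * H w) '' S) ∈ 𝓝 (0 : ℂ) :=
    (continuous_const_mul ζ).continuousAt.preimage_mem_nhds (by simpa using hS')
  have hev : ∀ᶠ v in 𝓝[≠] (0 : ℂ), (v ∈ (fun w => (w - z) * H w) '' S ∧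
      ζ * v ∈ (fun w => (w - z) * H w) '' S) ∧ v ≠ 0 :=
    Filter.inter_mem (nhdsWithin_le_nhds (Filter.inter_mem hS' hζS)) self_mem_nhdsWithin
  obtain ⟨v, ⟨⟨w₁, ⟨hw₁U, hw₁⟩, rfl⟩, ⟨w₂, ⟨hw₂U, hw₂⟩, h12⟩⟩, hv⟩ := hev.exists
  simp only at h12
  rw [h12, mul_pow, hζ.pow_eq_one, one_mul, ← hw₁, sub_left_inj] at hw₂
  have := hi hw₂U hw₁U hw₂
  subst this
  exact hζ.ne_one (by omega) (mul_right_cancel₀ hv (by rw [one_mul]; exact h12.symm))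

theorem isOpen_image_of_injOn {U : Set ℂ} (hU : IsOpen U) {f : ℂ → ℂ}
    (hf : DifferentiableOn ℂ f U) (hi : InjOn f U) : IsOpen (f '' U) := by
  refine isOpen_iff_mem_nhds.2 ?_
  rintro _ ⟨z, hz, rfl⟩
  have h := (hf.analyticAt (hU.mem_nhds hz)).hasStrictDerivAt
  rw [← h.map_nhds_eq (deriv_ne_zero_of_injOn hU hf hi hz)]
  exact image_mem_map (hU.mem_nhds hz)

theorem differentiableOn_invFunOn {U : Set ℂ} (hU : IsOpen U) {f : ℂ → ℂ}
    (hf : DifferentiableOn ℂ f U) (hi : InjOn f U) :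
    DifferentiableOn ℂ (Function.invFunOn f U) (f '' U) := by
  rintro _ ⟨z, hz, rfl⟩
  have h := (hf.analyticAt (hU.mem_nhds hz)).hasStrictDerivAt
  refine (h.to_local_left_inverse (deriv_ne_zero_of_injOn hU hf hi hz)
    ?_).hasDerivAt.differentiableAt.differentiableWithinAt
  filter_upwards [hU.mem_nhds hz] with w hw
  exact hi.leftInvOn_invFunOn hw

/-! ### Linearization of the symbol at its fixed point -/

/-- The cohomological equation `v - v ∘ φ = u` at an attracting fixed point. -/
theorem exists_sub_comp_eq {U : Set ℂ} (hU : IsOpen U) {φ u : ℂ → ℂ} (hφ : DifferentiableOn ℂ φ U)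
    (hm : MapsTo φ U U) (hu : DifferentiableOn ℂ u U) (hU0 : (0 : ℂ) ∈ U) (hu0 : u 0 = 0)
    (hφK : ∀ K ⊆ U, IsCompact K → ∃ r q : ℝ, 0 ≤ q ∧ q < 1 ∧ Metric.closedBall 0 r ⊆ U ∧
      ∀ k, ∀ z ∈ K, ‖φ^[k] z‖ ≤ q ^ k * r) :
    ∃ v, DifferentiableOn ℂ v U ∧ ∀ z ∈ U, v z - v (φ z) = u z := by
  have hit : ∀ k, MapsTo φ^[k] U U := fun k => hm.iterate k
  have hbound : ∀ K ⊆ U, IsCompact K → ∃ b : ℕ → ℝ, Summable b ∧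
      ∀ k, ∀ z ∈ K, ‖u (φ^[k] z)‖ ≤ b k := by
    intro K hK hKc
    obtain ⟨r, q, hq0, hq1, hrU, hr⟩ := hφK K hK hKc
    have hd : ContinuousOn (dslope u 0) U :=
      ((Complex.differentiableOn_dslope (hU.mem_nhds hU0)).2 hu).continuousOn
    obtain ⟨M, hM⟩ := (isCompact_closedBall (0 : ℂ) r).exists_bound_of_continuousOn (hd.mono hrU)
    refine ⟨fun k => q ^ k * (r * |M|), (summable_geometric_of_lt_one hq0 hq1).mul_right _,
      fun k z hz => ?_⟩
    have h1 := hr k z hz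
    have hrn : 0 ≤ r := by
      have := (norm_nonneg _).trans (hr 0 z hz)
      simpa using this
    have h2 : ‖φ^[k] z‖ ≤ r :=
      h1.trans (mul_le_of_le_one_left hrn (pow_le_one₀ hq0 hq1.le))
    have h3 : u (φ^[k] z) = φ^[k] z * dslope u 0 (φ^[k] z) := by
      have := sub_smul_dslope u 0 (φ^[k] z)
      rw [sub_zero, smul_eq_mul, hu0, sub_zero] at this
      exact this.symm
    dsimp only
    rw [h3, norm_mul, ← mul_assoc]
    exact mul_le_mul h1 ((hM _ (by simpa using h2)).trans (le_abs_self M)) (norm_nonneg _)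
      (by positivity)
  have hitd : ∀ k, DifferentiableOn ℂ (fun z => u (φ^[k] z)) U := fun k => by
    have : DifferentiableOn ℂ φ^[k] U := by
      induction k with
      | zero => exact differentiableOn_id
      | succ k ih => rw [Function.iterate_succ']; exact hφ.comp ih (hit k)
    exact hu.comp this (hit k)
  refine ⟨fun z => ∑' k, u (φ^[k] z), fun z hz => ?_, fun z hz => ?_⟩
  · obtain ⟨ε, hε, hεU⟩ := Metric.nhds_basis_closedBall.mem_iff.1 (hU.mem_nhds hz)
    obtain ⟨b, hb, hle⟩ := hbound _ hεU (isCompact_closedBall z ε)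
    exact ((Complex.differentiableOn_tsum_of_summable_norm hb
      (fun k => (hitd k).mono (Metric.ball_subset_closedBall.trans hεU)) Metric.isOpen_ball
      fun k w hw => hle k w (Metric.ball_subset_closedBall hw)).differentiableAt
      (Metric.ball_mem_nhds z hε)).differentiableWithinAt
  · obtain ⟨b, hb, hle⟩ := hbound {z} (singleton_subset_iff.2 hz) isCompact_singleton
    have hs : Summable fun k => u (φ^[k] z) :=
      Summable.of_norm_bounded hb fun k => hle k z rfl
    simp only [← Function.iterate_succ_apply]
    rw [hs.tsum_eq_zero_add]
    simp

section Contraction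

variable {ψ : ℂ → ℂ}

/-- The equality case of the Schwarz lemma would make `ψ` linear with `|ψ'(0)| = 1`. -/
theorem norm_dslope_lt_one (hψ : DifferentiableOn ℂ ψ (Metric.ball 0 1))
    (hm : MapsTo ψ (Metric.ball 0 1) (Metric.ball 0 1)) (h0 : ψ 0 = 0) (hd : ‖deriv ψ 0‖ < 1)
    {z : ℂ} (hz : z ∈ Metric.ball (0 : ℂ) 1) : ‖dslope ψ 0 z‖ < 1 := by
  have hm' : MapsTo ψ (Metric.ball 0 1) (Metric.closedBall (ψ 0) 1) := by
    rw [h0]; exact hm.mono_right Metric.ball_subset_closedBall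
  have hle := Complex.norm_dslope_le_div_of_mapsTo_ball hψ hm' hz
  rw [div_one] at hle
  refine lt_of_le_of_ne hle fun h => ?_
  have hEq := Complex.affine_of_mapsTo_ball_of_norm_dslope_eq_div hψ hm' hz (by rw [h, div_one])
  have hder : HasDerivAt ψ (dslope ψ 0 z) 0 := by
    have h1 : HasDerivAt (fun w : ℂ => ψ 0 + (w - 0) • dslope ψ 0 z) (dslope ψ 0 z) 0 := by
      have := (((hasDerivAt_id' (0 : ℂ)).sub_const 0).smul_const (dslope ψ 0 z)).const_add (ψ 0)
      simpa using this
    exact h1.congr_of_eventuallyEq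
      (hEq.eventuallyEq_of_mem (Metric.ball_mem_nhds 0 one_pos))
  rw [hder.deriv] at hd
  exact hd.ne h

/-- Iterates of a self-map of the disc with `|ψ'(0)| < 1` converge to the fixed point geometrically,
uniformly on compact sets. -/
theorem norm_iterate_le (hψ : DifferentiableOn ℂ ψ (Metric.ball 0 1))
    (hm : MapsTo ψ (Metric.ball 0 1) (Metric.ball 0 1)) (h0 : ψ 0 = 0) (hd : ‖deriv ψ 0‖ < 1)
    {K : Set ℂ} (hK : K ⊆ Metric.ball 0 1) (hKc : IsCompact K) :
    ∃ r q : ℝ, 0 ≤ q ∧ q < 1 ∧ Metric.closedBall 0 r ⊆ Metric.ball (0 : ℂ) 1 ∧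
      ∀ k, ∀ z ∈ K, ‖ψ^[k] z‖ ≤ q ^ k * r := by
  obtain ⟨r, hr0, hr1, hKr⟩ : ∃ r : ℝ, 0 ≤ r ∧ r < 1 ∧ ∀ z ∈ K, ‖z‖ ≤ r := by
    rcases K.eq_empty_or_nonempty with rfl | hne
    · exact ⟨0, le_rfl, one_pos, by simp⟩
    · obtain ⟨w, hw, hwm⟩ := hKc.exists_isMaxOn hne continuous_norm.continuousOn
      exact ⟨‖w‖, norm_nonneg _, by simpa using hK hw, fun z hz => hwm hz⟩
  have hsub : Metric.closedBall (0 : ℂ) r ⊆ Metric.ball 0 1 := Metric.closedBall_subset_ball hr1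
  have hcont : ContinuousOn (fun z => ‖dslope ψ 0 z‖) (Metric.closedBall 0 r) :=
    (((Complex.differentiableOn_dslope (Metric.ball_mem_nhds 0 one_pos)).2 hψ).continuousOn.mono
      hsub).norm
  obtain ⟨w, hw, hwm⟩ := (isCompact_closedBall (0 : ℂ) r).exists_isMaxOn
    ⟨0, by simpa using hr0⟩ hcont
  refine ⟨r, ‖dslope ψ 0 w‖, norm_nonneg _, norm_dslope_lt_one hψ hm h0 hd (hsub hw), hsub,
    fun k z hz => ?_⟩
  have hq1 := norm_dslope_lt_one hψ hm h0 hd (hsub hw)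
  induction k with
  | zero => simpa using hKr z hz
  | succ k ih =>
    rw [Function.iterate_succ_apply']
    have h1 : ‖ψ^[k] z‖ ≤ r :=
      ih.trans (mul_le_of_le_one_left hr0 (pow_le_one₀ (norm_nonneg _) hq1.le))
    have h2 : ψ (ψ^[k] z) = ψ^[k] z * dslope ψ 0 (ψ^[k] z) := by
      have := sub_smul_dslope ψ 0 (ψ^[k] z)
      rw [sub_zero, smul_eq_mul, h0, sub_zero] at this
      exact this.symm
    rw [h2, norm_mul, pow_succ, mul_right_comm]
    exact mul_le_mul ih (hwm (by simpa using h1)) (norm_nonneg _) (by positivity)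

/-- The Koenigs function `σ(z) = z exp (v z)` conjugates `ψ` to multiplication by `ψ'(0)`. -/
theorem exists_koenigs (hψ : DifferentiableOn ℂ ψ (Metric.ball 0 1))
    (hm : MapsTo ψ (Metric.ball 0 1) (Metric.ball 0 1)) (h0 : ψ 0 = 0) (hd : ‖deriv ψ 0‖ < 1)
    (hi : InjOn ψ (Metric.ball 0 1)) :
    ∃ v : ℂ → ℂ, DifferentiableOn ℂ v (Metric.ball 0 1) ∧
      InjOn (fun z => z * Complex.exp (v z)) (Metric.ball 0 1) ∧
      ∀ z ∈ Metric.ball (0 : ℂ) 1,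
        ψ z * Complex.exp (v (ψ z)) = deriv ψ 0 * (z * Complex.exp (v z)) := by
  have h0m : (0 : ℂ) ∈ Metric.ball (0 : ℂ) 1 := Metric.mem_ball_self one_pos
  have hval : ∀ z, ψ z = z * dslope ψ 0 z := fun z => by
    have := sub_smul_dslope ψ 0 z
    rw [sub_zero, smul_eq_mul, h0, sub_zero] at this
    exact this.symm
  have hne : ∀ z ∈ Metric.ball (0 : ℂ) 1, dslope ψ 0 z ≠ 0 := fun z hz h => by
    by_cases hz0 : z = 0
    · rw [hz0, dslope_same] at h
      exact deriv_ne_zero_of_injOn Metric.isOpen_ball hψ hi h0m h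
    · have := hval z
      rw [h, mul_zero, ← h0] at this
      exact hz0 (hi hz h0m this)
  obtain ⟨u, hu, hue⟩ := exists_eq_exp_of_ball one_pos
    ((Complex.differentiableOn_dslope (Metric.ball_mem_nhds 0 one_pos)).2 hψ) hne
  obtain ⟨v, hv, hve⟩ := exists_sub_comp_eq Metric.isOpen_ball hψ hm (hu.sub_const (u 0)) h0m
    (sub_self _) fun K hK hKc => norm_iterate_le hψ hm h0 hd hK hKc
  have hfun : ∀ z ∈ Metric.ball (0 : ℂ) 1,
      ψ z * Complex.exp (v (ψ z)) = deriv ψ 0 * (z * Complex.exp (v z)) := fun z hz => by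
    have h1 : v z = v (ψ z) + (u z - u 0) := by rw [← hve z hz]; ring
    have h2 := hue 0 h0m
    rw [dslope_same] at h2
    rw [h1, Complex.exp_add, Complex.exp_sub, ← hue z hz, ← h2, hval z]
    have : deriv ψ 0 ≠ 0 := deriv_ne_zero_of_injOn Metric.isOpen_ball hψ hi h0m
    field_simp
  refine ⟨v, hv, fun a ha b hb hab => ?_, hfun⟩
  set σ : ℂ → ℂ := fun z => z * Complex.exp (v z) with hσ
  have hσd : DifferentiableOn ℂ σ (Metric.ball 0 1) := differentiableOn_id.mul hv.cexp
  have hσa := (hσd.analyticAt (Metric.ball_mem_nhds 0 one_pos)).hasStrictDerivAt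
  have hσ' : deriv σ 0 ≠ 0 := by
    have h1 := (hasDerivAt_id' (0 : ℂ)).fun_mul
      ((hv.hasDerivAt (Metric.ball_mem_nhds 0 one_pos)).cexp)
    rw [h1.deriv]
    simp [Complex.exp_ne_zero]
  -- injectivity near `0` is pulled back along the iterates of `ψ`, which tend to `0`
  have hloc := hσa.eventually_left_inverse hσ'
  have hit : ∀ k z, z ∈ Metric.ball (0 : ℂ) 1 → σ (ψ^[k] z) = deriv ψ 0 ^ k * σ z := fun k z hz => by
    induction k with
    | zero => simp
    | succ k ih =>
      rw [Function.iterate_succ_apply', pow_succ', mul_assoc, ← ih]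
      exact hfun _ (hm.iterate k hz)
  have htend : ∀ z ∈ Metric.ball (0 : ℂ) 1, Tendsto (fun k => ψ^[k] z) atTop (𝓝 0) := fun z hz => by
    obtain ⟨r, q, hq0, hq1, -, hr⟩ := norm_iterate_le hψ hm h0 hd (singleton_subset_iff.2 hz)
      isCompact_singleton
    refine squeeze_zero_norm (fun k => hr k z rfl) ?_
    simpa using (tendsto_pow_atTop_nhds_zero_of_lt_one hq0 hq1).mul_const r
  obtain ⟨k, hka, hkb⟩ := (((htend a ha).eventually hloc).and ((htend b hb).eventually hloc)).exists
  have hk : ψ^[k] a = ψ^[k] b := by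
    rw [← hka, ← hkb, hit k a ha, hit k b hb, show σ a = σ b from hab]
  exact (hi.iterate hm k) ha hb hk

end Contraction

/-! ### Polynomial approximation in an injective coordinate -/

theorem inter_frontier_nonempty {X : Type*} [TopologicalSpace X] {s t : Set X}
    (ht : IsPreconnected t) (h1 : (t ∩ s).Nonempty) (h2 : (t ∩ sᶜ).Nonempty) :
    (t ∩ frontier s).Nonempty := by
  by_contra hne
  rw [not_nonempty_iff_eq_empty] at hne
  have hcov : ∀ x ∈ t, x ∈ interior s ∨ x ∈ interior sᶜ := fun x hx => by
    by_contra hx'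
    rw [not_or, interior_compl, mem_compl_iff, not_not] at hx'
    exact eq_empty_iff_forall_notMem.1 hne x ⟨hx, hx'.2, hx'.1⟩
  obtain ⟨x, -, hx1, hx2⟩ := ht _ _ isOpen_interior isOpen_interior hcov
    (h1.imp fun x hx => ⟨hx.1, (hcov x hx.1).resolve_right fun h => interior_subset h hx.2⟩)
    (h2.imp fun x hx => ⟨hx.1, (hcov x hx.1).resolve_left fun h => hx.2 (interior_subset h)⟩)
  exact interior_subset hx2 (interior_subset hx1)

/-- Passing to a closed subalgebra `A` may enlarge the spectrum of `x`, but only by bounded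
components of the complement, so that a connected set off the spectrum that reaches beyond `‖x‖` also
avoids the spectrum relative to `A`. -/
theorem notMem_spectrum_subalgebra {B : Type*} [NormedRing B] [NormedAlgebra ℂ B] [CompleteSpace B]
    [NormOneClass B] (A : Subalgebra ℂ B) (hA : IsClosed (A : Set B)) (x : A) {t : Set ℂ}
    (ht : IsPreconnected t) (hd : ∀ z ∈ t, z ∉ spectrum ℂ (x : B)) {w : ℂ} (hw : w ∈ t)
    (hwx : ‖(x : B)‖ < ‖w‖) {z : ℂ} (hz : z ∈ t) : z ∉ spectrum ℂ x := by
  have : CompleteSpace A := hA.completeSpace_coe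
  intro hmem
  have hw' : w ∉ spectrum ℂ x := fun h => by
    have h1 := spectrum.norm_le_norm_mul_of_mem h
    have h2 : ‖(1 : A)‖ = 1 := (norm_one : ‖(1 : B)‖ = 1)
    rw [h2, mul_one] at h1
    exact absurd h1 (not_le.2 hwx)
  obtain ⟨y, hy, hfr⟩ := inter_frontier_nonempty ht ⟨z, hz, hmem⟩ ⟨w, hw, hw'⟩
  exact hd y hy (Subalgebra.frontier_spectrum A x hfr)

/-- The image under `σ` of the annulus `r < |z| < 1` is connected, misses `σ` of the disc `|z| ≤ r`,
which is the spectrum of `s` in the algebra of continuous functions, and reaches beyond `‖s‖`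
because `σ` is open. -/
theorem notMem_spectrum_of_closed_subalgebra {σ : ℂ → ℂ} (hσ : DifferentiableOn ℂ σ (Metric.ball 0 1))
    (hi : InjOn σ (Metric.ball 0 1)) {r : ℝ} (hr0 : 0 < r) (hr1 : r < 1)
    (s : C(Metric.closedBall (0 : ℂ) r, ℂ)) (hs : ∀ z, s z = σ z)
    (A : Subalgebra ℂ C(Metric.closedBall (0 : ℂ) r, ℂ)) (hA : IsClosed (A : Set C(Metric.closedBall (0 : ℂ) r, ℂ)))
    (x : A) (hx : (x : C(Metric.closedBall (0 : ℂ) r, ℂ)) = s) {ζ : ℂ} (hζ : r < ‖ζ‖) (hζ1 : ‖ζ‖ < 1) :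
    σ ζ ∉ spectrum ℂ x := by
  have hne' : Nonempty (Metric.closedBall (0 : ℂ) r) := ⟨⟨0, by simpa using hr0.le⟩⟩
  have hsub : Metric.closedBall (0 : ℂ) r ⊆ Metric.ball 0 1 := Metric.closedBall_subset_ball hr1
  set An : Set ℂ := {z : ℂ | r < ‖z‖ ∧ ‖z‖ < 1 ∧ z ≠ 0} with hAn
  have hpre : IsPreconnected (σ '' An) := (isPreconnected_annulus r 1).image σ
    (hσ.continuousOn.mono fun z hz => by simpa using hz.2.1)
  have hne : (Metric.closedBall (0 : ℂ) r).Nonempty := ⟨0, by simpa using hr0.le⟩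
  -- a point of the annulus where `|σ|` exceeds its maximum on the disc
  obtain ⟨w, hwA, hw⟩ : ∃ w ∈ An, ‖s‖ < ‖σ w‖ := by
    obtain ⟨z₁, hz₁, hmax⟩ := (isCompact_closedBall (0 : ℂ) r).exists_isMaxOn hne
      (hσ.continuousOn.mono hsub).norm
    have hs1 : ‖s‖ ≤ ‖σ z₁‖ := (ContinuousMap.norm_le _ (norm_nonneg _)).2 fun z => by
      rw [hs]; exact hmax z.2
    have hnhds : σ '' Metric.ball 0 1 ∈ 𝓝 (σ z₁) :=
      (isOpen_image_of_injOn Metric.isOpen_ball hσ hi).mem_nhds (mem_image_of_mem _ (hsub hz₁))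
    obtain ⟨ε, hε, hεs⟩ := Metric.mem_nhds_iff.1 hnhds
    obtain ⟨p, hp, hpn⟩ : ∃ p ∈ Metric.ball (σ z₁) ε, ‖σ z₁‖ < ‖p‖ := by
      by_cases h0 : σ z₁ = 0
      · refine ⟨((ε / 2 : ℝ) : ℂ), ?_, ?_⟩
        · rw [h0, mem_ball_zero_iff, Complex.norm_real, Real.norm_of_nonneg (by positivity)]
          linarith
        · rw [h0, norm_zero, Complex.norm_real, Real.norm_of_nonneg (by positivity)]
          positivity
      · have hpos := norm_pos_iff.2 h0
        refine ⟨σ z₁ + ((ε / 2 / ‖σ z₁‖ : ℝ) : ℂ) * σ z₁, ?_, ?_⟩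
        · rw [mem_ball_iff_norm, add_sub_cancel_left, norm_mul, Complex.norm_real,
            Real.norm_of_nonneg (by positivity), div_mul_cancel₀ _ hpos.ne']
          linarith
        · have : σ z₁ + ((ε / 2 / ‖σ z₁‖ : ℝ) : ℂ) * σ z₁ =
              ((1 + ε / 2 / ‖σ z₁‖ : ℝ) : ℂ) * σ z₁ := by push_cast; ring
          rw [this, norm_mul, Complex.norm_real, Real.norm_of_nonneg (by positivity)]
          have : 0 < ε / 2 / ‖σ z₁‖ := by positivity
          nlinarith
    obtain ⟨w, hw, rfl⟩ := hεs hp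
    have hwr : r < ‖w‖ := by
      by_contra hle
      have : ‖σ w‖ ≤ ‖σ z₁‖ := hmax (show w ∈ Metric.closedBall (0 : ℂ) r by simpa using hle)
      linarith
    exact ⟨w, ⟨hwr, by simpa using hw, norm_pos_iff.1 (hr0.trans hwr)⟩, hs1.trans_lt hpn⟩
  have hζA : ζ ∈ An := ⟨hζ, hζ1, norm_pos_iff.1 (hr0.trans hζ)⟩
  refine notMem_spectrum_subalgebra A hA x hpre ?_ (mem_image_of_mem σ hwA) (by rwa [hx])
    (mem_image_of_mem σ hζA)
  rintro _ ⟨η, hη, rfl⟩ h1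
  rw [hx] at h1
  rw [ContinuousMap.spectrum_eq_range] at h1
  obtain ⟨z, hz⟩ := h1
  rw [hs] at hz
  have h2 := hi (hsub z.2) (show η ∈ Metric.ball (0 : ℂ) 1 by simpa using hη.2.1) hz
  have h3 : ‖(z : ℂ)‖ ≤ r := mem_closedBall_zero_iff.1 z.2
  rw [h2] at h3
  exact absurd hη.1 (not_lt.2 h3)

/-- A Runge theorem: if `σ` is injective and holomorphic on the unit disc, then the polynomials in
`σ` are dense in `H(𝔻)`. -/
theorem exists_polynomial_comp_approx {σ P : ℂ → ℂ} (hσ : DifferentiableOn ℂ σ (Metric.ball 0 1))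
    (hi : InjOn σ (Metric.ball 0 1)) (hP : DifferentiableOn ℂ P (Metric.ball 0 1))
    {r ε : ℝ} (hr0 : 0 < r) (hr1 : r < 1) (hε : 0 < ε) :
    ∃ q : Polynomial ℂ, ∀ z, ‖z‖ ≤ r → ‖P z - q.eval (σ z)‖ < ε := by
  have hsub : Metric.closedBall (0 : ℂ) r ⊆ Metric.ball 0 1 := Metric.closedBall_subset_ball hr1
  have hne : Nonempty (Metric.closedBall (0 : ℂ) r) := ⟨⟨0, by simpa using hr0.le⟩⟩
  let s : C(Metric.closedBall (0 : ℂ) r, ℂ) := ⟨fun z => σ z,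
    continuousOn_iff_continuous_domRestrict.1 (hσ.continuousOn.mono hsub)⟩
  let p : C(Metric.closedBall (0 : ℂ) r, ℂ) := ⟨fun z => P z,
    continuousOn_iff_continuous_domRestrict.1 (hP.continuousOn.mono hsub)⟩
  suffices hmem : ∀ A : Subalgebra ℂ C(Metric.closedBall (0 : ℂ) r, ℂ),
      IsClosed (A : Set C(Metric.closedBall (0 : ℂ) r, ℂ)) → s ∈ A → p ∈ A by
    have hcl := hmem (Algebra.adjoin ℂ {s}).topologicalClosure
      (Subalgebra.isClosed_topologicalClosure _)
      (Subalgebra.le_topologicalClosure _ (Algebra.self_mem_adjoin_singleton ℂ s))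
    obtain ⟨t, ht, hpt⟩ := Metric.mem_closure_iff.1 hcl ε hε
    rw [SetLike.mem_coe, Algebra.adjoin_singleton_eq_range_aeval] at ht
    obtain ⟨q, rfl⟩ := ht
    refine ⟨q, fun z hz => ?_⟩
    have h1 := (ContinuousMap.dist_lt_iff hε).1 hpt ⟨z, by simpa using hz⟩
    rw [dist_eq_norm] at h1
    have h2 : (Polynomial.aeval s q : C(Metric.closedBall (0 : ℂ) r, ℂ)) ⟨z, by simpa using hz⟩ =
        q.eval (σ z) := by
      rw [Polynomial.aeval_continuousMap_apply]
      rfl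
    change ‖P z - (Polynomial.aeval s q : C(Metric.closedBall (0 : ℂ) r, ℂ)) ⟨z, _⟩‖ < ε at h1
    rwa [h2] at h1
  intro A hA hsA
  have : CompleteSpace A := hA.completeSpace_coe
  let x : A := ⟨s, hsA⟩
  obtain ⟨ρ, hρr, hρ1⟩ := exists_between hr1
  have hρ0 : 0 < ρ := hr0.trans hρr
  have hunit : ∀ ζ ∈ Metric.sphere (0 : ℂ) ρ, IsUnit (algebraMap ℂ A (σ ζ) - x) := fun ζ hζ => by
    rw [mem_sphere_zero_iff_norm] at hζ
    exact spectrum.notMem_iff.1 (notMem_spectrum_of_closed_subalgebra hσ hi hr0 hr1 s (fun _ => rfl)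
      A hA x rfl (by rw [hζ]; exact hρr) (by rw [hζ]; exact hρ1))
  have hsph : Metric.sphere (0 : ℂ) ρ ⊆ Metric.ball 0 1 :=
    Metric.sphere_subset_closedBall.trans (Metric.closedBall_subset_ball hρ1)
  let G : ℂ → A := fun ζ => (P ζ * deriv σ ζ) • Ring.inverse (algebraMap ℂ A (σ ζ) - x)
  have hG : ContinuousOn G (Metric.sphere 0 ρ) := by
    refine ((hP.continuousOn.mono hsph).mul
      ((hσ.deriv Metric.isOpen_ball).continuousOn.mono hsph)).smul fun ζ hζ => ?_
    obtain ⟨u, hu⟩ := hunit ζ hζ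
    have h1 : ContinuousWithinAt (fun ζ => algebraMap ℂ A (σ ζ) - x) (Metric.sphere 0 ρ) ζ :=
      ((continuous_algebraMap ℂ A).continuousAt.comp_continuousWithinAt
        (hσ.continuousOn.mono hsph ζ hζ)).sub continuousWithinAt_const
    have h2 : ContinuousAt Ring.inverse (algebraMap ℂ A (σ ζ) - x) := by
      rw [← hu]; exact NormedRing.inverse_continuousAt u
    exact ContinuousAt.comp_continuousWithinAt (f := fun ζ => algebraMap ℂ A (σ ζ) - x) h2 h1
  -- Cauchy's formula in the coordinate `σ`; the integrand, hence the integral, has values in `A`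
  have hint : ((2 * Real.pi * Complex.I : ℂ)⁻¹ • ∮ ζ in C(0, ρ), G ζ : A) = p := by
    ext z
    let ev : A →L[ℂ] ℂ := (ContinuousMap.evalCLM ℂ z).comp A.toSubmodule.subtypeL
    have hev : ∀ ζ ∈ Metric.sphere (0 : ℂ) ρ,
        ev (G ζ) = P ζ * deriv σ ζ * (σ ζ - σ z)⁻¹ := fun ζ hζ => by
      have h1 := congrArg ev (Ring.mul_inverse_cancel _ (hunit ζ hζ))
      have h2 : ev (G ζ) = P ζ * deriv σ ζ * ev (Ring.inverse (algebraMap ℂ A (σ ζ) - x)) := by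
        simp only [G, map_smul, smul_eq_mul]
      have h3 : (σ ζ - σ z) * ev (Ring.inverse (algebraMap ℂ A (σ ζ) - x)) = 1 := h1
      rw [h2, eq_inv_of_mul_eq_one_right h3]
    have hcomm : ev (∮ ζ in C(0, ρ), G ζ) = ∮ ζ in C(0, ρ), ev (G ζ) := by
      simp only [circleIntegral]
      rw [← ContinuousLinearMap.intervalIntegral_comp_comm]
      · simp only [map_smul]
      · exact (hG.circleIntegrable hρ0.le).out
    change ev ((2 * Real.pi * Complex.I : ℂ)⁻¹ • ∮ ζ in C(0, ρ), G ζ) = P z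
    rw [map_smul, hcomm, circleIntegral.integral_congr hρ0.le hev]
    have hzρ : (z : ℂ) ∈ Metric.ball (0 : ℂ) ρ :=
      Metric.closedBall_subset_ball hρr z.2
    have hz1 := hsub z.2
    have hds := (Complex.differentiableOn_dslope (Metric.isOpen_ball.mem_nhds hz1)).2 hσ
    have hds0 : ∀ ζ ∈ Metric.ball (0 : ℂ) 1, dslope σ z ζ ≠ 0 := fun ζ hζ h => by
      by_cases hζz : ζ = z
      · rw [hζz, dslope_same] at h
        exact deriv_ne_zero_of_injOn Metric.isOpen_ball hσ hi hz1 h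
      · have := sub_smul_dslope σ z ζ
        rw [h, smul_zero] at this
        exact hζz (hi hζ hz1 (sub_eq_zero.1 this.symm))
    have hF : DifferentiableOn ℂ (fun ζ => P ζ * deriv σ ζ / dslope σ z ζ) (Metric.ball 0 1) :=
      (hP.mul (hσ.deriv Metric.isOpen_ball)).div hds hds0
    have hC := (hF.mono (Metric.closedBall_subset_ball hρ1)).circleIntegral_sub_inv_smul hzρ
    have hcongr : (∮ ζ in C(0, ρ), P ζ * deriv σ ζ * (σ ζ - σ z)⁻¹) =
        ∮ ζ in C(0, ρ), (ζ - z)⁻¹ • (P ζ * deriv σ ζ / dslope σ z ζ) := by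
      refine circleIntegral.integral_congr hρ0.le fun ζ hζ => ?_
      have h1 := sub_smul_dslope σ z ζ
      simp only [smul_eq_mul] at h1 ⊢
      rw [← h1, mul_inv]
      ring
    rw [hcongr, hC, dslope_same, mul_div_cancel_right₀ _
      (deriv_ne_zero_of_injOn Metric.isOpen_ball hσ hi hz1), smul_smul,
      inv_mul_cancel₀ Complex.two_pi_I_ne_zero, one_smul]
  rw [← hint]
  exact Subtype.property _

/-! ### A model of the operator -/

/-- A Laurent splitting in the coordinate `σ`. -/
theorem exists_splitting_coordinate {σ f : ℂ → ℂ} (hσ : DifferentiableOn ℂ σ (Metric.ball 0 1))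
    (hi : InjOn σ (Metric.ball 0 1)) (h0 : σ 0 = 0) (hf : DifferentiableOn ℂ f puncturedDisc) :
    ∃ P N : ℂ → ℂ, DifferentiableOn ℂ P (Metric.ball 0 1) ∧ Differentiable ℂ N ∧
      ∀ z ∈ puncturedDisc, f z = P z + N (σ z)⁻¹ := by
  have h0b : (0 : ℂ) ∈ Metric.ball (0 : ℂ) 1 := Metric.mem_ball_self one_pos
  have hσ0 : ∀ z ∈ puncturedDisc, σ z ≠ 0 := fun z hz h =>
    hz.2 (hi hz.1 h0b (h.trans h0.symm))
  have hopen := isOpen_image_of_injOn Metric.isOpen_ball hσ hi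
  obtain ⟨R, hR, hRσ⟩ := Metric.isOpen_iff.1 hopen 0 ⟨0, h0b, h0⟩
  set h := Function.invFunOn σ (Metric.ball 0 1) with hh
  have hmaps : MapsTo h (Metric.ball 0 R \ {0}) puncturedDisc := fun w hw => by
    refine ⟨Function.invFunOn_mem (hRσ hw.1), fun hw0 => hw.2 ?_⟩
    have := Function.invFunOn_eq (hRσ hw.1)
    change σ (h w) = w at this
    rw [mem_singleton_iff.1 hw0, h0] at this
    exact this.symm
  obtain ⟨P₀, N, hP₀, hN, hPN⟩ := exists_laurent_splitting hR (f := fun w => f (h w))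
    (hf.comp ((differentiableOn_invFunOn Metric.isOpen_ball hσ hi).mono
      fun w hw => hRσ hw.1) hmaps)
  have hg : DifferentiableOn ℂ (fun z => f z - N (σ z)⁻¹) (Metric.ball 0 1 \ {0}) :=
    hf.sub (hN.comp_differentiableOn ((hσ.mono sdiff_subset).inv hσ0))
  have hev : ∀ᶠ z in 𝓝 (0 : ℂ), z ∈ Metric.ball (0 : ℂ) 1 ∧ σ z ∈ Metric.ball 0 R ∧
      ‖P₀ (σ z)‖ < ‖P₀ 0‖ + 1 := by
    have hσc : Tendsto σ (𝓝 0) (𝓝 0) := by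
      have := (hσ.continuousOn.continuousAt (Metric.ball_mem_nhds 0 one_pos)).tendsto
      rwa [h0] at this
    have hPc : Tendsto (fun z => ‖P₀ (σ z)‖) (𝓝 0) (𝓝 ‖P₀ 0‖) :=
      ((hP₀.continuousOn.continuousAt (Metric.ball_mem_nhds 0 hR)).tendsto.comp hσc).norm
    filter_upwards [Metric.ball_mem_nhds 0 one_pos, hσc (Metric.ball_mem_nhds 0 hR),
      hPc.eventually_lt_const (lt_add_one _)] with z h1 h2 h3 using ⟨h1, h2, h3⟩
  obtain ⟨r, hr, hrb⟩ := Metric.eventually_nhds_iff_ball.1 hev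
  obtain ⟨P, hP, hPg⟩ := exists_extension_of_bounded hr one_pos hg (C := ‖P₀ 0‖ + 1)
    fun z hz hzr => by
      obtain ⟨h1, h2, h3⟩ := hrb z (by simpa using hzr)
      have h4 : f z - N (σ z)⁻¹ = P₀ (σ z) := by
        have h5 := hPN (σ z) (hσ0 z ⟨h1, hz⟩)
        simp only [hh, hi.leftInvOn_invFunOn h1] at h5
        rw [h5, add_sub_cancel_right]
      rw [h4]
      exact h3.le
  exact ⟨P, N, hP, hN, fun z hz => by rw [hPg z hz.2, sub_add_cancel]⟩

/-- Up to a constant, every holomorphic function on the punctured disc is a coboundary for a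
self-map that is linear in the coordinate `σ`: the two parts of the splitting are summed along the
forward orbits of `ψ` and of `t ↦ λ t`, where `t = 1 / σ`. -/
theorem exists_sub_comp_eq_sub_const {ψ σ W : ℂ → ℂ} (hψ : DifferentiableOn ℂ ψ (Metric.ball 0 1))
    (hm : MapsTo ψ (Metric.ball 0 1) (Metric.ball 0 1)) (h0 : ψ 0 = 0) (hd : ‖deriv ψ 0‖ < 1)
    (hd0 : deriv ψ 0 ≠ 0) (hσ : DifferentiableOn ℂ σ (Metric.ball 0 1))
    (hi : InjOn σ (Metric.ball 0 1)) (hσ0 : σ 0 = 0)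
    (hσψ : ∀ z ∈ Metric.ball (0 : ℂ) 1, σ (ψ z) = deriv ψ 0 * σ z)
    (hW : DifferentiableOn ℂ W puncturedDisc) :
    ∃ G : ℂ → ℂ, ∃ c : ℂ, DifferentiableOn ℂ G puncturedDisc ∧
      ∀ z ∈ puncturedDisc, G z - G (ψ z) = W z - c := by
  have h0b : (0 : ℂ) ∈ Metric.ball (0 : ℂ) 1 := Metric.mem_ball_self one_pos
  obtain ⟨P, N, hP, hN, hPN⟩ := exists_splitting_coordinate hσ hi hσ0 hW
  obtain ⟨V, hV, hVψ⟩ := exists_sub_comp_eq Metric.isOpen_ball hψ hm (u := fun z => P z - P 0)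
    (hP.sub_const _) h0b (sub_self _) fun K hK hKc => norm_iterate_le hψ hm h0 hd hK hKc
  obtain ⟨M, hM, hMl⟩ := exists_sub_comp_eq isOpen_univ (φ := fun t => deriv ψ 0 * t)
    (differentiable_id.const_mul _).differentiableOn (mapsTo_univ _ _) (u := fun t => N t - N 0)
    (hN.sub_const _).differentiableOn (mem_univ _) (sub_self _) fun K _ hKc => by
      obtain ⟨r, hr⟩ := hKc.isBounded.exists_norm_le
      refine ⟨r, ‖deriv ψ 0‖, norm_nonneg _, hd, subset_univ _, fun k z hz => ?_⟩
      rw [mul_left_iterate_apply, norm_mul, norm_pow]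
      exact mul_le_mul_of_nonneg_left (hr z hz) (by positivity)
  have hσne : ∀ z ∈ puncturedDisc, σ z ≠ 0 := fun z hz h =>
    hz.2 (hi hz.1 h0b (h.trans hσ0.symm))
  refine ⟨fun z => V z - M (deriv ψ 0 * (σ z)⁻¹), P 0 + N 0, (hV.mono sdiff_subset).sub
    ((differentiableOn_univ.1 hM).comp_differentiableOn
      (((hσ.mono sdiff_subset).inv hσne).const_mul _)), fun z hz => ?_⟩
  have h1 := hVψ z hz.1
  have h2 := hMl (σ z)⁻¹ (mem_univ _)
  simp only at h1 h2 ⊢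
  rw [hσψ z hz.1, hPN z hz, mul_inv, mul_inv_cancel_left₀ hd0]
  linear_combination h1 + h2

/-- With `σ` as coordinate and `g` as gauge, `f ↦ ω · f ∘ ψ` becomes
`F(w) ↦ c wⁿ F(λ w)`, `λ = ψ'(0)`. -/
theorem exists_linear_model {ψ ω W : ℂ → ℂ} {n : ℤ} (hψ : DifferentiableOn ℂ ψ (Metric.ball 0 1))
    (hm : MapsTo ψ (Metric.ball 0 1) (Metric.ball 0 1)) (h0 : ψ 0 = 0) (hd : ‖deriv ψ 0‖ < 1)
    (hψi : InjOn ψ (Metric.ball 0 1)) (hW : DifferentiableOn ℂ W puncturedDisc)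
    (hω : ∀ z ∈ puncturedDisc, ω z = z ^ n * Complex.exp (W z)) :
    ∃ σ g : ℂ → ℂ, ∃ c : ℂ, DifferentiableOn ℂ σ (Metric.ball 0 1) ∧ InjOn σ (Metric.ball 0 1) ∧
      σ 0 = 0 ∧ (∀ z ∈ Metric.ball (0 : ℂ) 1, σ (ψ z) = deriv ψ 0 * σ z) ∧
      DifferentiableOn ℂ g puncturedDisc ∧ (∀ z, g z ≠ 0) ∧ c ≠ 0 ∧
      ∀ z ∈ puncturedDisc, ω z * g (ψ z) = c * σ z ^ n * g z := by
  obtain ⟨v, hv, hi, hvψ⟩ := exists_koenigs hψ hm h0 hd hψi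
  have hd0 := deriv_ne_zero_of_injOn Metric.isOpen_ball hψ hψi (Metric.mem_ball_self one_pos)
  have hσ : DifferentiableOn ℂ (fun z => z * Complex.exp (v z)) (Metric.ball 0 1) :=
    differentiableOn_id.mul hv.cexp
  obtain ⟨G, c, hG, hGψ⟩ := exists_sub_comp_eq_sub_const hψ hm h0 hd hd0 hσ hi (zero_mul _) hvψ
    (hW.sub ((hv.mono sdiff_subset).const_mul (n : ℂ)))
  refine ⟨fun z => z * Complex.exp (v z), fun z => Complex.exp (G z), Complex.exp c, hσ, hi,
    zero_mul _, hvψ, hG.cexp, fun z => Complex.exp_ne_zero _, Complex.exp_ne_zero _,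
    fun z hz => ?_⟩
  have h1 := hGψ z hz
  have h2 : G (ψ z) = G z - W z + n * v z + c := by
    simp only [Pi.sub_apply] at h1
    linear_combination -h1
  simp only
  rw [hω z hz, h2, mul_zpow, ← Complex.exp_int_mul, Complex.exp_add, Complex.exp_add,
    Complex.exp_sub]
  field_simp

/-! ### The criterion for the model -/

theorem summable_prod_const_mul_pow {a q : ℝ} (ha : 0 ≤ a) (hq0 : 0 ≤ q) (hq : q < 1) :
    Summable fun k : ℕ => ∏ j ∈ Finset.range k, a * q ^ j := by
  have h0 : ∀ k : ℕ, 0 ≤ ∏ j ∈ Finset.range k, a * q ^ j := fun k =>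
    Finset.prod_nonneg fun j _ => by positivity
  have hlim : Tendsto (fun k : ℕ => a * q ^ k) atTop (𝓝 0) := by
    simpa using (tendsto_pow_atTop_nhds_zero_of_lt_one hq0 hq).const_mul a
  refine summable_of_ratio_norm_eventually_le (r := 1 / 2) (by norm_num) ?_
  filter_upwards [hlim.eventually_le_const (show (0 : ℝ) < 1 / 2 by norm_num)] with k hk
  rw [Real.norm_of_nonneg (h0 _), Real.norm_of_nonneg (h0 _), Finset.prod_range_succ, mul_comm]
  exact mul_le_mul_of_nonneg_right hk (h0 k)

/-- The term ratios `C μᵏ h` tend to zero uniformly on compact sets. -/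
theorem HolSpace.summable_of_ratio {t : ℕ → HolSpace puncturedDisc} {h : ℂ → ℂ} {C μ : ℂ}
    (hh : ContinuousOn h puncturedDisc) (hμ : ‖μ‖ < 1)
    (ht : ∀ k, ∀ z ∈ puncturedDisc,
      HolSpace.toFun (t (k + 1)) z = C * μ ^ k * h z * HolSpace.toFun (t k) z) :
    Summable t := by
  refine summable_of_norm_le fun K hK hKc => ?_
  obtain ⟨H, hH⟩ := (hKc.image_of_continuousOn (hh.mono hK)).isBounded.exists_norm_le
  obtain ⟨B, hB⟩ := (hKc.image_of_continuousOn
    ((differentiableOn_toFun (t 0)).continuousOn.mono hK)).isBounded.exists_norm_le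
  refine ⟨fun k => |B| * ∏ j ∈ Finset.range k, ‖C‖ * |H| * ‖μ‖ ^ j,
    (summable_prod_const_mul_pow (by positivity) (norm_nonneg _) hμ).mul_left _, fun k z hz => ?_⟩
  induction k with
  | zero =>
    beta_reduce
    rw [Finset.range_zero, Finset.prod_empty, mul_one]
    exact (hB _ (mem_image_of_mem _ hz)).trans (le_abs_self B)
  | succ k ih =>
    beta_reduce at ih ⊢
    rw [ht k z (hK hz), Finset.prod_range_succ, norm_mul, norm_mul, norm_mul, norm_pow]
    have := (hH _ (mem_image_of_mem _ hz)).trans (le_abs_self H)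
    calc _ ≤ ‖C‖ * ‖μ‖ ^ k * |H| * (|B| * ∏ j ∈ Finset.range k, ‖C‖ * |H| * ‖μ‖ ^ j) := by gcongr
      _ = _ := by ring

/-- Every holomorphic function on `𝔻*` is approximated, uniformly on compact sets, by linear
combinations of the functions `g σᵐ`, `m ∈ ℤ`. -/
theorem dense_span_mul_zpow {σ g : ℂ → ℂ} (hσ : DifferentiableOn ℂ σ (Metric.ball 0 1))
    (hi : InjOn σ (Metric.ball 0 1)) (h0 : σ 0 = 0) (hg : DifferentiableOn ℂ g puncturedDisc)
    (hg0 : ∀ z, g z ≠ 0) {e : ℤ → HolSpace puncturedDisc}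
    (he : ∀ m, ∀ z ∈ puncturedDisc, HolSpace.toFun (e m) z = g z * σ z ^ m) :
    Dense (Submodule.span ℂ (range e) : Set (HolSpace puncturedDisc)) := by
  have hpoly : ∀ (j : ℤ) (q : Polynomial ℂ), ∃ x ∈ Submodule.span ℂ (range e),
      ∀ z ∈ puncturedDisc, HolSpace.toFun x z = g z * q.eval (σ z ^ j) := fun j q => by
    induction q using Polynomial.induction_on' with
    | add p q hp hq =>
      obtain ⟨x, hx, hxp⟩ := hp
      obtain ⟨y, hy, hyq⟩ := hq
      refine ⟨x + y, add_mem hx hy, fun z hz => ?_⟩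
      rw [HolSpace.toFun_add, hxp z hz, hyq z hz, Polynomial.eval_add, mul_add]
    | monomial n a =>
      refine ⟨a • e (j * n), Submodule.smul_mem _ _ (Submodule.subset_span ⟨_, rfl⟩),
        fun z hz => ?_⟩
      rw [HolSpace.toFun_smul, he _ z hz, Polynomial.eval_monomial, zpow_mul, zpow_natCast]
      ring
  have h0b : (0 : ℂ) ∈ Metric.ball (0 : ℂ) 1 := Metric.mem_ball_self one_pos
  have hσ0 : ∀ z ∈ puncturedDisc, σ z ≠ 0 := fun z hz h =>
    hz.2 (hi hz.1 h0b (h.trans h0.symm))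
  intro f
  obtain ⟨P, N, hP, hN, hPN⟩ := exists_splitting_coordinate hσ hi h0
    ((HolSpace.differentiableOn_toFun f).div hg fun z _ => hg0 z)
  refine HolSpace.mem_closure_of_forall_compact fun K hK hKc ε hε => ?_
  obtain ⟨r, hr0, hr1, hKr⟩ : ∃ r : ℝ, 0 < r ∧ r < 1 ∧ ∀ z ∈ K, ‖z‖ ≤ r := by
    obtain ⟨r, ⟨hr0, hr1⟩, hr⟩ := exists_pos_lt_subset_ball one_pos hKc.isClosed
      (hK.trans sdiff_subset)
    exact ⟨r, hr0, hr1, fun z hz => (mem_ball_zero_iff.1 (hr hz)).le⟩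
  obtain ⟨B, hB⟩ := (hKc.image_of_continuousOn (hg.continuousOn.mono hK)).isBounded.exists_norm_le
  obtain ⟨D, hD⟩ := (hKc.image_of_continuousOn (f := fun z => (σ z)⁻¹)
    (((hσ.continuousOn.mono sdiff_subset).inv₀ hσ0).mono hK)).isBounded.exists_norm_le
  set δ := ε / (2 * (|B| + 1)) with hδ
  have hδ0 : 0 < δ := by positivity
  obtain ⟨q₁, hq₁⟩ := exists_polynomial_comp_approx hσ hi hP hr0 hr1 hδ0
  -- rescaling reduces the approximation of `N` on a large disc to the one on a disc of radius `1/2`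
  set s : ℝ := 2 * (|D| + 1) with hs
  have hs0 : (s : ℂ) ≠ 0 := Complex.ofReal_ne_zero.2 (by positivity)
  obtain ⟨q₂, hq₂⟩ := exists_polynomial_comp_approx (σ := fun t => t) (P := fun t => N (s * t))
    differentiableOn_id (injOn_id _)
    (hN.comp (differentiable_id.const_mul (s : ℂ))).differentiableOn
    (r := 1 / 2) (by norm_num) (by norm_num) hδ0
  obtain ⟨x, hx, hxq⟩ := hpoly 1 q₁
  obtain ⟨y, hy, hyq⟩ := hpoly (-1) (q₂.comp (Polynomial.C (s : ℂ)⁻¹ * Polynomial.X))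
  refine ⟨x + y, add_mem hx hy, fun z hz => ?_⟩
  have h1 := hq₁ z (hKr z hz)
  have h2 := hq₂ ((s : ℂ)⁻¹ * (σ z)⁻¹) (by
    have := (hD _ (mem_image_of_mem _ hz)).trans (le_abs_self D)
    rw [norm_mul, norm_inv, Complex.norm_real, Real.norm_of_nonneg (by positivity), hs, mul_comm,
      ← div_eq_mul_inv, div_le_div_iff₀ (by positivity) (by norm_num)]
    linarith)
  have h3 := hPN z (hK hz)
  rw [Pi.div_apply, div_eq_iff (hg0 z)] at h3
  rw [HolSpace.toFun_add, hxq z (hK hz), hyq z (hK hz), h3, zpow_one, zpow_neg_one,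
    Polynomial.eval_comp, Polynomial.eval_mul, Polynomial.eval_C, Polynomial.eval_X]
  rw [mul_inv_cancel_left₀ hs0] at h2
  have h4 : (P z + N (σ z)⁻¹) * g z -
      (g z * q₁.eval (σ z) + g z * q₂.eval ((s : ℂ)⁻¹ * (σ z)⁻¹)) =
      g z * ((P z - q₁.eval (σ z)) + (N (σ z)⁻¹ - q₂.eval ((s : ℂ)⁻¹ * (σ z)⁻¹))) := by ring
  have h5 := (hB _ (mem_image_of_mem _ hz)).trans (le_abs_self B)
  rw [h4, norm_mul]
  calc _ ≤ |B| * (δ + δ) := mul_le_mul h5 ((norm_add_le _ _).trans (add_le_add h1.le h2.le))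
        (norm_nonneg _) (abs_nonneg _)
    _ < (|B| + 1) * (δ + δ) := by nlinarith
    _ = ε := by rw [hδ]; field_simp; norm_num

/-- A weighted shift `e m ↦ c λᵐ e (m + n)` with `|λ| < 1` and `n ≥ 1` satisfies the criterion: both the
forward and the backward weights decay super-exponentially along orbits. -/
theorem frequentHypercyclicityCriterion_of_model {T : HolSpace puncturedDisc →L[ℂ] HolSpace puncturedDisc}
    {σ g : ℂ → ℂ} {c l : ℂ} {n : ℕ} (hn : 1 ≤ n) (hc : c ≠ 0) (hl0 : l ≠ 0) (hl : ‖l‖ < 1)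
    (hσ : DifferentiableOn ℂ σ (Metric.ball 0 1))
    (hi : InjOn σ (Metric.ball 0 1)) (h0 : σ 0 = 0) (hg : DifferentiableOn ℂ g puncturedDisc)
    (hg0 : ∀ z, g z ≠ 0) (hT : Function.Injective T) {e : ℤ → HolSpace puncturedDisc}
    (he : ∀ m, ∀ z ∈ puncturedDisc, HolSpace.toFun (e m) z = g z * σ z ^ m)
    (hTe : ∀ m, T (e m) = (c * l ^ m) • e (m + n)) :
    LinDyn.FrequentHypercyclicityCriterion T := by
  have h0b : (0 : ℂ) ∈ Metric.ball (0 : ℂ) 1 := Metric.mem_ball_self one_pos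
  have hσ0 : ∀ z ∈ puncturedDisc, σ z ≠ 0 := fun z hz h =>
    hz.2 (hi hz.1 h0b (h.trans h0.symm))
  have hσc : ContinuousOn σ puncturedDisc := hσ.continuousOn.mono sdiff_subset
  have hcl : ∀ m : ℤ, c * l ^ m ≠ 0 := fun m => mul_ne_zero hc (zpow_ne_zero _ hl0)
  have hln : ‖l ^ n‖ < 1 := by
    rw [norm_pow]; exact pow_lt_one₀ (norm_nonneg l) hl (by omega)
  have hback : ∀ m, e m = T ((c * l ^ (m - n))⁻¹ • e (m - n)) := fun m => by
    rw [map_smul, hTe, smul_smul, inv_mul_cancel₀ (hcl _), one_smul, sub_add_cancel]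
  set E := Submodule.span ℂ (range e) with hE
  have heE : ∀ m, e m ∈ E := fun m => Submodule.subset_span ⟨m, rfl⟩
  have hTE : ∀ x ∈ E, T x ∈ E := fun x hx => by
    induction hx using Submodule.span_induction with
    | mem x hx =>
      obtain ⟨m, rfl⟩ := hx
      rw [hTe]
      exact E.smul_mem _ (heE _)
    | zero => rw [map_zero]; exact E.zero_mem
    | add x y _ _ hx hy => rw [map_add]; exact E.add_mem hx hy
    | smul a x _ hx => rw [map_smul]; exact E.smul_mem _ hx
  have hsurj : ∀ x ∈ E, ∃ y ∈ E, T y = x := fun x hx => by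
    induction hx using Submodule.span_induction with
    | mem x hx =>
      obtain ⟨m, rfl⟩ := hx
      exact ⟨_, E.smul_mem _ (heE _), (hback m).symm⟩
    | zero => exact ⟨0, E.zero_mem, map_zero _⟩
    | add x y _ _ hx hy =>
      obtain ⟨x', hx', rfl⟩ := hx
      obtain ⟨y', hy', rfl⟩ := hy
      exact ⟨x' + y', E.add_mem hx' hy', map_add _ _ _⟩
    | smul a x _ hx =>
      obtain ⟨x', hx', rfl⟩ := hx
      exact ⟨a • x', E.smul_mem _ hx', map_smul _ _ _⟩
  let TR : E →ₗ[ℂ] E := (T : HolSpace puncturedDisc →ₗ[ℂ] HolSpace puncturedDisc).restrict hTE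
  let TE : E ≃ₗ[ℂ] E := LinearEquiv.ofBijective TR
    ⟨fun x y hxy => Subtype.ext (hT (show T x = T y from congrArg (fun u : E => (u : HolSpace puncturedDisc)) hxy)), fun x => by
      obtain ⟨y, hy, hyx⟩ := hsurj x x.2
      exact ⟨⟨y, hy⟩, Subtype.ext hyx⟩⟩
  have hTS : ∀ x : E, T (TE.symm x : HolSpace puncturedDisc) = x := fun x =>
    congrArg Subtype.val (TE.apply_symm_apply x)
  have hSe : ∀ m, ((TE.symm ⟨e m, heE m⟩ : E) : HolSpace puncturedDisc) =
      (c * l ^ (m - n))⁻¹ • e (m - n) := fun m => hT <| by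
    rw [hTS, ← hback]
  have hS' : ∀ k (x : E), TE.symm^[k] x = ((TE.symm : E →ₗ[ℂ] E) ^ k) x := fun k x => by
    rw [Module.End.pow_apply]; rfl
  have hT' : ∀ k x, T^[k] x = ((T : HolSpace puncturedDisc →ₗ[ℂ] _) ^ k) x := fun k x => by
    rw [Module.End.pow_apply]; rfl
  -- iterates of the basis vectors
  have hTk : ∀ m (k : ℕ), ∃ a : ℂ, T^[k] (e m) = a • e (m + k * n) := fun m k => by
    induction k with
    | zero => exact ⟨1, by simp⟩
    | succ k ih =>
      obtain ⟨a, ha⟩ := ih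
      refine ⟨a * (c * l ^ (m + k * n)), ?_⟩
      rw [Function.iterate_succ_apply', ha, map_smul, hTe, smul_smul]
      congr 2
      push_cast; ring
  have hSk : ∀ m (k : ℕ), ∃ a : ℂ, TE.symm^[k] ⟨e m, heE m⟩ =
      a • (⟨e (m - k * n), heE _⟩ : E) := fun m k => by
    induction k with
    | zero => exact ⟨1, Subtype.ext (by simp)⟩
    | succ k ih =>
      obtain ⟨a, ha⟩ := ih
      refine ⟨a * (c * l ^ (m - k * n - n))⁻¹, Subtype.ext ?_⟩
      rw [Function.iterate_succ_apply', ha, map_smul, Submodule.coe_smul, hSe, smul_smul,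
        Submodule.coe_smul]
      congr 2
      push_cast; ring
  have hTsum : ∀ x ∈ E, Summable fun k : ℕ => T^[k + 1] x := fun x hx => by
    simp only [hT']
    induction hx using Submodule.span_induction with
    | mem x hx =>
      obtain ⟨m, rfl⟩ := hx
      simp only [← hT']
      refine (summable_nat_add_iff (f := fun k => T^[k] (e m)) 1).2
        (HolSpace.summable_of_ratio (h := fun z => σ z ^ n) (C := c * l ^ m) (hσc.pow n) hln
          fun k z hz => ?_)
      obtain ⟨a, ha⟩ := hTk m k
      rw [Function.iterate_succ_apply', ha, map_smul, hTe, smul_smul, HolSpace.toFun_smul,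
        HolSpace.toFun_smul, he _ z hz, he _ z hz, zpow_add₀ hl0, zpow_add₀ (hσ0 z hz) _ (n : ℤ),
        zpow_natCast, mul_comm (k : ℤ) n, zpow_mul, zpow_natCast, zpow_natCast]
      ring
    | zero => simp
    | add x y _ _ hx hy => simpa only [map_add] using hx.add hy
    | smul a x _ hx => simpa only [map_smul] using hx.const_smul a
  have hSsum : ∀ x (hx : x ∈ E), Summable fun k : ℕ =>
      ((TE.symm^[k + 1] ⟨x, hx⟩ : E) : HolSpace puncturedDisc) := fun x hx => by
    simp only [hS']
    induction hx using Submodule.span_induction with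
    | mem x hx =>
      obtain ⟨m, rfl⟩ := hx
      simp only [← hS']
      refine (summable_nat_add_iff
        (f := fun k => ((TE.symm^[k] ⟨e m, heE m⟩ : E) : HolSpace puncturedDisc)) 1).2
        (HolSpace.summable_of_ratio (h := fun z => (σ z ^ n)⁻¹) (C := (c * l ^ (m - n))⁻¹)
          ((hσc.pow n).inv₀ fun z hz => pow_ne_zero _ (hσ0 z hz)) hln
          fun k z hz => ?_)
      obtain ⟨a, ha⟩ := hSk m k
      rw [Function.iterate_succ_apply', ha, map_smul, Submodule.coe_smul, hSe, smul_smul,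
        Submodule.coe_smul, HolSpace.toFun_smul,
        HolSpace.toFun_smul, he _ z hz, he _ z hz, zpow_sub₀ (hσ0 z hz) _ (n : ℤ),
        show m - (k : ℤ) * n - n = (m - n) - n * k by ring, zpow_sub₀ hl0 (m - n), zpow_mul]
      simp only [zpow_natCast]
      field_simp
    | zero =>
      have h : (⟨0, E.zero_mem⟩ : E) = 0 := rfl
      simp only [h, map_zero, Submodule.coe_zero]
      exact summable_zero
    | add x y hx' hy' hx hy =>
      have h : (⟨x + y, E.add_mem hx' hy'⟩ : E) = ⟨x, hx'⟩ + ⟨y, hy'⟩ := rfl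
      simp only [h, map_add]
      exact hx.add hy
    | smul a x hx' hx =>
      have h : (⟨a • x, E.smul_mem a hx'⟩ : E) = a • ⟨x, hx'⟩ := rfl
      simp only [h, map_smul]
      exact hx.const_smul a
  exact ⟨E, dense_span_mul_zpow hσ hi h0 hg hg0 he, TE.symm, fun f =>
    ⟨hTsum f f.2, hSsum f f.2, hTS f⟩⟩

/-! ### Self-maps of the punctured disc -/

theorem exists_extension_of_mapsTo {ψ : ℂ → ℂ} (hψ : DifferentiableOn ℂ ψ puncturedDisc)
    (hm : MapsTo ψ puncturedDisc puncturedDisc) :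
    ∃ Ψ, DifferentiableOn ℂ Ψ (Metric.ball 0 1) ∧ ∀ z, z ≠ 0 → Ψ z = ψ z :=
  exists_extension_of_bounded (C := 1) one_pos one_pos hψ fun _ hz hz1 =>
    (mem_puncturedDisc.1 (hm (mem_puncturedDisc.2 ⟨hz1, hz⟩))).1.le

theorem nhdsWithin_puncturedDisc_zero : 𝓝[puncturedDisc] (0 : ℂ) = 𝓝[≠] 0 := by
  rw [puncturedDisc, sdiff_eq]
  exact nhdsWithin_inter_of_mem (mem_nhdsWithin_of_mem_nhds (Metric.ball_mem_nhds (0 : ℂ) one_pos))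

section Extension

variable {ψ Ψ : ℂ → ℂ}

theorem mapsTo_ball_of_extension (hm : MapsTo ψ puncturedDisc puncturedDisc)
    (h : ∀ z, z ≠ 0 → Ψ z = ψ z) (h0 : Ψ 0 = 0) :
    MapsTo Ψ (Metric.ball 0 1) (Metric.ball 0 1) := fun z hz => by
  by_cases hz0 : z = 0
  · rw [hz0, h0]; exact Metric.mem_ball_self one_pos
  · rw [h z hz0]; exact (hm ⟨hz, hz0⟩).1

theorem injOn_ball_of_extension (hm : MapsTo ψ puncturedDisc puncturedDisc)
    (hi : InjOn ψ puncturedDisc)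
    (h : ∀ z, z ≠ 0 → Ψ z = ψ z) (h0 : Ψ 0 = 0) : InjOn Ψ (Metric.ball 0 1) := fun z hz w hw hzw => by
  by_cases hz0 : z = 0 <;> by_cases hw0 : w = 0
  · rw [hz0, hw0]
  · rw [hz0, h0, h w hw0] at hzw
    exact absurd hzw.symm (hm ⟨hw, hw0⟩).2
  · rw [hw0, h0, h z hz0] at hzw
    exact absurd hzw (hm ⟨hz, hz0⟩).2
  · rw [h z hz0, h w hw0] at hzw
    exact hi ⟨hz, hz0⟩ ⟨hw, hw0⟩ hzw

end Extension

section Schwarz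

variable {ψ : ℂ → ℂ}

theorem norm_deriv_zero_le_one (hψ : DifferentiableOn ℂ ψ (Metric.ball 0 1))
    (hm : MapsTo ψ (Metric.ball 0 1) (Metric.ball 0 1)) (h0 : ψ 0 = 0) : ‖deriv ψ 0‖ ≤ 1 := by
  have hm' : MapsTo ψ (Metric.ball 0 1) (Metric.closedBall (ψ 0) 1) := by
    rw [h0]; exact hm.mono_right Metric.ball_subset_closedBall
  have := Complex.norm_dslope_le_div_of_mapsTo_ball hψ hm' (Metric.mem_ball_self one_pos)
  rwa [dslope_same, div_one] at this

theorem eq_deriv_mul_of_one_le_norm_deriv (hψ : DifferentiableOn ℂ ψ (Metric.ball 0 1))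
    (hm : MapsTo ψ (Metric.ball 0 1) (Metric.ball 0 1)) (h0 : ψ 0 = 0) (h1 : 1 ≤ ‖deriv ψ 0‖)
    {z : ℂ} (hz : z ∈ Metric.ball (0 : ℂ) 1) : ψ z = deriv ψ 0 * z := by
  have hm' : MapsTo ψ (Metric.ball 0 1) (Metric.closedBall (ψ 0) 1) := by
    rw [h0]; exact hm.mono_right Metric.ball_subset_closedBall
  have := Complex.affine_of_mapsTo_ball_of_norm_dslope_eq_div hψ hm' (Metric.mem_ball_self one_pos)
    (by rw [dslope_same, div_one]; exact (norm_deriv_zero_le_one hψ hm h0).antisymm h1) hz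
  simpa [h0, mul_comm] using this

/-- The Schwarz lemma for the inverse map. -/
theorem one_le_norm_deriv_of_surjOn (hψ : DifferentiableOn ℂ ψ (Metric.ball 0 1))
    (hi : InjOn ψ (Metric.ball 0 1)) (h0 : ψ 0 = 0)
    (hs : SurjOn ψ (Metric.ball 0 1) (Metric.ball 0 1)) : 1 ≤ ‖deriv ψ 0‖ := by
  have h0b : (0 : ℂ) ∈ Metric.ball (0 : ℂ) 1 := Metric.mem_ball_self one_pos
  have hd := (differentiableOn_invFunOn Metric.isOpen_ball hψ hi).mono hs
  have hinv0 : Function.invFunOn ψ (Metric.ball 0 1) 0 = 0 := by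
    have := hi.leftInvOn_invFunOn h0b
    rwa [h0] at this
  have hle := norm_deriv_zero_le_one hd (fun w hw => Function.invFunOn_mem (hs hw)) hinv0
  have hcomp : HasDerivAt (fun z => Function.invFunOn ψ (Metric.ball 0 1) (ψ z))
      (deriv (Function.invFunOn ψ (Metric.ball 0 1)) 0 * deriv ψ 0) 0 := by
    refine HasDerivAt.comp (h := ψ) (h₂ := Function.invFunOn ψ (Metric.ball 0 1)) 0 ?_ (hψ.hasDerivAt (Metric.ball_mem_nhds 0 one_pos))
    rw [h0]
    exact hd.hasDerivAt (Metric.ball_mem_nhds 0 one_pos)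
  have hid : HasDerivAt (fun z => Function.invFunOn ψ (Metric.ball 0 1) (ψ z)) 1 0 :=
    (hasDerivAt_id' (0 : ℂ)).congr_of_eventuallyEq
      (hi.leftInvOn_invFunOn.eqOn.eventuallyEq_of_mem (Metric.ball_mem_nhds 0 one_pos))
  have h1 := congrArg norm (hcomp.unique hid)
  rw [norm_mul, norm_one] at h1
  nlinarith [norm_nonneg (deriv ψ 0)]

theorem norm_deriv_lt_one_of_not_surjOn (hψ : DifferentiableOn ℂ ψ (Metric.ball 0 1))
    (hm : MapsTo ψ (Metric.ball 0 1) (Metric.ball 0 1)) (h0 : ψ 0 = 0)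
    (hs : ¬ SurjOn ψ puncturedDisc puncturedDisc) : ‖deriv ψ 0‖ < 1 := by
  by_contra! h1
  refine hs fun w hw => ?_
  have hd1 : ‖deriv ψ 0‖ = 1 := (norm_deriv_zero_le_one hψ hm h0).antisymm h1
  have hd0 : deriv ψ 0 ≠ 0 := norm_pos_iff.1 (hd1 ▸ one_pos)
  have hmem : w / deriv ψ 0 ∈ puncturedDisc := by
    rw [mem_puncturedDisc, norm_div, hd1, div_one]
    exact ⟨norm_lt_one_of_mem_puncturedDisc hw, div_ne_zero hw.2 hd0⟩
  exact ⟨_, hmem, by rw [eq_deriv_mul_of_one_le_norm_deriv hψ hm h0 h1 hmem.1, mul_div_cancel₀ _ hd0]⟩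

end Schwarz

/-! ### Sufficiency -/

/-- The range of `ψ` is open, so the identity theorem applies. -/
theorem weightedComp_injective {ω ψ : ℂ → ℂ} (hω : DifferentiableOn ℂ ω puncturedDisc)
    (hψ : DifferentiableOn ℂ ψ puncturedDisc) (hm : MapsTo ψ puncturedDisc puncturedDisc)
    (hω0 : ∀ z ∈ puncturedDisc, ω z ≠ 0) (hi : InjOn ψ puncturedDisc) :
    Function.Injective (weightedComp puncturedDisc isOpen_puncturedDisc ω ψ hω hψ hm) := by
  intro f g hfg
  have hEq : ∀ z ∈ puncturedDisc, HolSpace.toFun f (ψ z) = HolSpace.toFun g (ψ z) := fun z hz => by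
    have := congrArg (fun u => HolSpace.toFun u z) hfg
    simp only [HolSpace.toFun_weightedComp isOpen_puncturedDisc hω hψ hm _ hz] at this
    exact mul_left_cancel₀ (hω0 z hz) this
  have hne : (1 / 2 : ℂ) ∈ puncturedDisc := mem_puncturedDisc.2 ⟨by norm_num, by norm_num⟩
  have hopen := isOpen_image_of_injOn isOpen_puncturedDisc hψ hi
  refine HolSpace.ext_toFun ?_
  refine ((HolSpace.differentiableOn_toFun f).analyticOnNhd
    isOpen_puncturedDisc).eqOn_of_preconnected_of_eventuallyEq
    ((HolSpace.differentiableOn_toFun g).analyticOnNhd isOpen_puncturedDisc)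
    isPreconnected_puncturedDisc (hm hne) ?_
  filter_upwards [hopen.mem_nhds (mem_image_of_mem ψ hne)]
  rintro _ ⟨z, hz, rfl⟩
  exact hEq z hz

/-- In the model, the functions `g σᵐ`, `m ∈ ℤ`, are shifted by `n ≥ 1`, with weights `c λᵐ`,
`λ = ψ'(0)`; non-surjectivity of `ψ` gives `|λ| < 1`. -/
theorem frequentHypercyclicityCriterion_weightedComp {ω ψ W : ℂ → ℂ} {n : ℕ}
    (hω : DifferentiableOn ℂ ω puncturedDisc)
    (hψ : DifferentiableOn ℂ ψ puncturedDisc) (hm : MapsTo ψ puncturedDisc puncturedDisc)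
    (hn : 1 ≤ n) (hW : DifferentiableOn ℂ W puncturedDisc)
    (hωW : ∀ z ∈ puncturedDisc, ω z = z ^ n * Complex.exp (W z)) (hi : InjOn ψ puncturedDisc)
    (hs : ¬ SurjOn ψ puncturedDisc puncturedDisc) (h0 : Tendsto ψ (𝓝[puncturedDisc] 0) (𝓝 0)) :
    LinDyn.FrequentHypercyclicityCriterion
      (weightedComp puncturedDisc isOpen_puncturedDisc ω ψ hω hψ hm) := by
  obtain ⟨Ψ, hΨ, hΨψ⟩ := exists_extension_of_mapsTo hψ hm
  have hΨψ' : EqOn Ψ ψ puncturedDisc := fun z hz => hΨψ z hz.2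
  have hΨ0 : Ψ 0 = 0 := by
    have h1 : Tendsto Ψ (𝓝[puncturedDisc] 0) (𝓝 (Ψ 0)) :=
      (hΨ.continuousOn.continuousAt (Metric.ball_mem_nhds 0 one_pos)).tendsto.mono_left
        nhdsWithin_le_nhds
    have h2 : Tendsto Ψ (𝓝[puncturedDisc] 0) (𝓝 0) :=
      h0.congr' (hΨψ'.symm.eventuallyEq_of_mem self_mem_nhdsWithin)
    have : (𝓝[puncturedDisc] (0 : ℂ)).NeBot := by
      rw [nhdsWithin_puncturedDisc_zero]; infer_instance
    exact tendsto_nhds_unique h1 h2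
  have hΨm := mapsTo_ball_of_extension hm hΨψ hΨ0
  have hΨi := injOn_ball_of_extension hm hi hΨψ hΨ0
  have hd := norm_deriv_lt_one_of_not_surjOn hΨ hΨm hΨ0 fun h => hs fun w hw => by
    obtain ⟨z, hz, hzw⟩ := h hw
    exact ⟨z, hz, by rw [← hΨψ' hz, hzw]⟩
  have hd0 := deriv_ne_zero_of_injOn Metric.isOpen_ball hΨ hΨi (Metric.mem_ball_self one_pos)
  have hω0 : ∀ z ∈ puncturedDisc, ω z ≠ 0 := fun z hz => by
    rw [hωW z hz]
    exact mul_ne_zero (pow_ne_zero _ hz.2) (Complex.exp_ne_zero _)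
  obtain ⟨σ, g, c, hσ, hσi, hσ0, hσΨ, hg, hg0, hc, hmodel⟩ := exists_linear_model (n := n)
    hΨ hΨm hΨ0 hd hΨi hW (by simpa only [zpow_natCast] using hωW)
  have hσne : ∀ z ∈ puncturedDisc, σ z ≠ 0 := fun z hz h =>
    hz.2 (hσi hz.1 (Metric.mem_ball_self one_pos) (h.trans hσ0.symm))
  have he : ∀ m : ℤ, DifferentiableOn ℂ (fun z => g z * σ z ^ m) puncturedDisc := fun m =>
    hg.mul ((hσ.mono sdiff_subset).zpow (Or.inl hσne))
  refine frequentHypercyclicityCriterion_of_model hn hc hd0 hd hσ hσi hσ0 hg hg0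
    (weightedComp_injective hω hψ hm hω0 hi) (e := fun m => HolSpace.ofDiff _ (he m))
    (fun m z hz => HolSpace.toFun_ofDiff (he m) hz) fun m => HolSpace.ext_toFun fun z hz => ?_
  rw [HolSpace.toFun_weightedComp isOpen_puncturedDisc hω hψ hm _ hz,
    HolSpace.toFun_ofDiff (he m) (hm hz), HolSpace.toFun_smul, HolSpace.toFun_ofDiff (he _) hz,
    ← hΨψ' hz, hσΨ z hz.1, mul_zpow, zpow_add₀ (hσne z hz)]
  linear_combination deriv Ψ 0 ^ m * σ z ^ m * hmodel z hz

/-! ### Functionals on `H(Ω)` -/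

namespace HolSpace

variable {Ω : Set ℂ}

/-- Evaluation at a point, as a linear functional (zero if the point is not in `Ω`). -/
noncomputable def evalLinear (z : ℂ) : HolSpace Ω →ₗ[ℂ] ℂ where
  toFun f := toFun f z
  map_add' f g := toFun_add f g z
  map_smul' c f := toFun_smul c f z

/-- Averages over a circle, with a continuous density `k` and along a continuous change of variable
`γ`, are continuous functionals on `H(Ω)`; they provide the Laurent coefficients. -/
theorem exists_circleAverage_functional (hΩ : IsOpen Ω) {ρ : ℝ} (hρ : 0 ≤ ρ) {k γ : ℂ → ℂ}
    (hk : ContinuousOn k (Metric.sphere 0 ρ)) (hγ : ContinuousOn γ (Metric.sphere 0 ρ))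
    (hγm : MapsTo γ (Metric.sphere 0 ρ) Ω) :
    ∃ L : HolSpace Ω →ₗ[ℂ] ℂ, Continuous L ∧
      ∀ f, L f = Real.circleAverage (fun w => k w * toFun f (γ w)) 0 ρ := by
  have hs : ∀ θ, circleMap 0 ρ θ ∈ Metric.sphere (0 : ℂ) ρ := circleMap_mem_sphere 0 hρ
  have hint : ∀ f : HolSpace Ω, CircleIntegrable (fun w => k w * toFun f (γ w)) 0 ρ := fun f =>
    (hk.mul ((differentiableOn_toFun f).continuousOn.comp hγ hγm)).circleIntegrable hρ
  refine ⟨{ toFun := fun f => Real.circleAverage (fun w => k w * toFun f (γ w)) 0 ρ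
            map_add' := fun f g => ?_
            map_smul' := fun c f => ?_ }, ?_, fun f => rfl⟩
  · rw [← Real.circleAverage_fun_add (hint f) (hint g)]
    simp only [toFun_add, mul_add]
  · rw [RingHom.id_apply, ← Real.circleAverage_fun_smul]
    simp only [toFun_smul, smul_eq_mul, mul_left_comm]
  · have h := (continuous_circleIntegral hΩ (γ := fun θ => γ (circleMap 0 ρ θ))
      (k := fun θ => k (circleMap 0 ρ θ))
      (hγ.comp_continuous (continuous_circleMap 0 ρ) hs) (fun θ => hγm (hs θ))
      (hk.comp_continuous (continuous_circleMap 0 ρ) hs) 0 (2 * Real.pi)).const_smul (2 * Real.pi)⁻¹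
    exact h

theorem eventually_norm_sub_lt {K : Set ℂ} (hK : K ⊆ Ω) (hKc : IsCompact K) (h : HolSpace Ω)
    {ε : ℝ} (hε : 0 < ε) : ∀ᶠ f in 𝓝 h, ∀ z ∈ K, ‖toFun h z - toFun f z‖ < ε := by
  have h1 : Tendsto (fun f : HolSpace Ω => (f : C(Ω, ℂ))) (𝓝 h) (𝓝 (h : C(Ω, ℂ))) :=
    continuous_subtype_val.tendsto h
  have h2 := ContinuousMap.tendsto_iff_forall_isCompact_tendstoUniformlyOn.1 h1 ((↑) ⁻¹' K)
    (Topology.IsInducing.subtypeVal.isCompact_preimage_iff (by simpa using hK) |>.2 hKc)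
  filter_upwards [Metric.tendstoUniformlyOn_iff.1 h2 ε hε] with f hf z hz
  have := hf ⟨z, hK hz⟩ hz
  rw [dist_eq_norm] at this
  rwa [← toFun_coe, ← toFun_coe] at this

end HolSpace

theorem LinDyn.Hypercyclic.exists_iterate_approx {Ω : Set ℂ} {T : HolSpace Ω →L[ℂ] HolSpace Ω}
    {f : HolSpace Ω} (hf : Dense (range fun n : ℕ => T^[n] f)) {K : Set ℂ} (hK : K ⊆ Ω)
    (hKc : IsCompact K) (h : HolSpace Ω) {ε : ℝ} (hε : 0 < ε) :
    ∃ n : ℕ, ∀ z ∈ K, ‖HolSpace.toFun h z - HolSpace.toFun (T^[n] f) z‖ < ε := by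
  obtain ⟨_, hx, n, rfl⟩ := mem_closure_iff_nhds.1 (hf h) _
    (HolSpace.eventually_norm_sub_lt hK hKc h hε)
  exact ⟨n, hx⟩

/-! ### Necessary conditions on the symbols -/

section Necessity

variable {ω ψ : ℂ → ℂ} {hω : DifferentiableOn ℂ ω puncturedDisc}
  {hψ : DifferentiableOn ℂ ψ puncturedDisc} {hm : MapsTo ψ puncturedDisc puncturedDisc}

/-- If `ω z = 0`, then evaluation at `z` vanishes on the range of the operator. -/
theorem weight_ne_zero_of_hypercyclic
    (hT : LinDyn.Hypercyclic (weightedComp puncturedDisc isOpen_puncturedDisc ω ψ hω hψ hm)) {z : ℂ}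
    (hz : z ∈ puncturedDisc) : ω z ≠ 0 := fun h => by
  have hL := hT.eq_zero_of_comp_eq_zero (HolSpace.evalLinear z) (HolSpace.continuous_toFun hz)
    fun f => by
      change HolSpace.toFun _ z = 0
      rw [HolSpace.toFun_weightedComp isOpen_puncturedDisc hω hψ hm f hz, h, zero_mul]
  have h1 := LinearMap.congr_fun hL (HolSpace.ofDiff (fun _ => 1) (differentiableOn_const 1))
  change HolSpace.toFun _ z = 0 at h1
  rw [HolSpace.toFun_ofDiff _ hz] at h1
  exact one_ne_zero h1

theorem injOn_of_hypercyclic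
    (hT : LinDyn.Hypercyclic (weightedComp puncturedDisc isOpen_puncturedDisc ω ψ hω hψ hm)) :
    InjOn ψ puncturedDisc := fun a ha b hb hab => by
  -- if `ψ a = ψ b`, then `f ↦ ω(b) f(a) - ω(a) f(b)` vanishes on the range
  have hL := hT.eq_zero_of_comp_eq_zero (ω b • HolSpace.evalLinear a - ω a • HolSpace.evalLinear b)
    (((HolSpace.continuous_toFun ha).const_smul (ω b)).sub
      ((HolSpace.continuous_toFun hb).const_smul (ω a))) fun f => by
      change ω b * HolSpace.toFun _ a - ω a * HolSpace.toFun _ b = 0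
      rw [HolSpace.toFun_weightedComp isOpen_puncturedDisc hω hψ hm f ha,
        HolSpace.toFun_weightedComp isOpen_puncturedDisc hω hψ hm f hb, hab]
      ring
  have h1 := LinearMap.congr_fun hL
    (HolSpace.ofDiff (fun z => z - b) (differentiableOn_id.sub_const b))
  change ω b * HolSpace.toFun _ a - ω a * HolSpace.toFun _ b = 0 at h1
  rw [HolSpace.toFun_ofDiff _ ha, HolSpace.toFun_ofDiff _ hb, sub_self, mul_zero, sub_zero] at h1
  exact sub_eq_zero.1 ((mul_eq_zero.1 h1).resolve_left (weight_ne_zero_of_hypercyclic hT hb))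

/-- If `ψ` extended to `0` with a value other than `0`, then `f ∘ ψ` would extend holomorphically
to `0` for every `f`, and the residue of `f / ω` would vanish on the range of the operator. -/
theorem extension_zero_eq_zero_of_hypercyclic
    (hT : LinDyn.Hypercyclic (weightedComp puncturedDisc isOpen_puncturedDisc ω ψ hω hψ hm))
    {Ψ : ℂ → ℂ} (hΨ : DifferentiableOn ℂ Ψ (Metric.ball 0 1)) (hΨψ : ∀ z, z ≠ 0 → Ψ z = ψ z) :
    Ψ 0 = 0 := by
  by_contra hp
  have h0b : (0 : ℂ) ∈ Metric.ball (0 : ℂ) 1 := Metric.mem_ball_self one_pos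
  have hle : ∀ z ∈ Metric.ball (0 : ℂ) 1, z ≠ 0 → ‖Ψ z‖ < 1 := fun z hz hz0 => by
    rw [hΨψ z hz0]; exact norm_lt_one_of_mem_puncturedDisc (hm ⟨hz, hz0⟩)
  have hlt : ‖Ψ 0‖ < 1 := by
    by_contra! h1
    have hmax : IsMaxOn (norm ∘ Ψ) (Metric.ball 0 1) 0 := fun z hz => by
      change ‖Ψ z‖ ≤ ‖Ψ 0‖
      by_cases hz0 : z = 0
      · rw [hz0]
      · exact (hle z hz hz0).le.trans h1
    have hmem : (1 / 2 : ℂ) ∈ puncturedDisc := mem_puncturedDisc.2 ⟨by norm_num, by norm_num⟩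
    have h2 := Complex.norm_eqOn_of_isPreconnected_of_isMaxOn
      (convex_ball (0 : ℂ) 1).isPreconnected Metric.isOpen_ball hΨ h0b hmax hmem.1
    exact absurd (h1.trans h2.symm.le) (not_le.2 (hle _ hmem.1 hmem.2))
  have hmaps : MapsTo Ψ (Metric.ball 0 1) puncturedDisc := fun z hz => by
    by_cases hz0 : z = 0
    · rw [hz0]; exact mem_puncturedDisc.2 ⟨hlt, hp⟩
    · rw [hΨψ z hz0]; exact hm ⟨hz, hz0⟩
  have hsph : Metric.sphere (0 : ℂ) (1 / 2) ⊆ puncturedDisc := fun z hz => by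
    rw [mem_sphere_zero_iff_norm] at hz
    exact mem_puncturedDisc.2 ⟨by rw [hz]; norm_num, norm_pos_iff.1 (by rw [hz]; norm_num)⟩
  have hω0 : ∀ z ∈ puncturedDisc, ω z ≠ 0 := fun z hz => weight_ne_zero_of_hypercyclic hT hz
  -- the residue of `f / ω` at the origin vanishes on the range, where `f / ω` is bounded near `0`
  obtain ⟨L, hLc, hL⟩ := HolSpace.exists_circleAverage_functional isOpen_puncturedDisc
    (ρ := 1 / 2) (by norm_num) (k := fun z => z / ω z) (γ := fun z => z)
    (continuousOn_id.div (hω.continuousOn.mono hsph) fun z hz => hω0 z (hsph hz))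
    continuousOn_id hsph
  have hL0 := hT.eq_zero_of_comp_eq_zero L hLc fun f => by
    have hd : DifferentiableOn ℂ (fun z => z * HolSpace.toFun f (Ψ z)) (Metric.ball 0 1) :=
      differentiableOn_id.mul ((HolSpace.differentiableOn_toFun f).comp hΨ hmaps)
    rw [hL, Real.circleAverage_congr_sphere (f₂ := fun z => z * HolSpace.toFun f (Ψ z)),
      DiffContOnCl.circleAverage, zero_mul]
    · exact hd.diffContOnCl_ball (Metric.closedBall_subset_ball (by norm_num [abs_of_pos]))
    · intro z hz
      rw [abs_of_pos (by norm_num)] at hz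
      simp only
      rw [HolSpace.toFun_weightedComp isOpen_puncturedDisc hω hψ hm f (hsph hz),
        hΨψ z (hsph hz).2, ← mul_assoc, div_mul_cancel₀ _ (hω0 z (hsph hz))]
  have hd : DifferentiableOn ℂ (fun z => ω z / z) puncturedDisc :=
    hω.div differentiableOn_id fun z hz => hz.2
  have h1 := LinearMap.congr_fun hL0 (HolSpace.ofDiff _ hd)
  rw [hL, Real.circleAverage_congr_sphere (f₂ := fun _ => 1), Real.circleAverage_const] at h1
  · exact one_ne_zero h1
  · intro z hz
    rw [abs_of_pos (by norm_num)] at hz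
    simp only
    rw [HolSpace.toFun_ofDiff hd (hsph hz), div_mul_div_cancel₀ (hω0 z (hsph hz)),
      div_self (hsph hz).2]

theorem toFun_iterate_rotation {l : ℂ}
    (hψl : ∀ z ∈ puncturedDisc, ψ z = l * z) (f : HolSpace puncturedDisc) (k : ℕ) {z : ℂ}
    (hz : z ∈ puncturedDisc) :
    HolSpace.toFun ((weightedComp puncturedDisc isOpen_puncturedDisc ω ψ hω hψ hm)^[k] f) z =
      (∏ j ∈ Finset.range k, ω (l ^ j * z)) * HolSpace.toFun f (l ^ k * z) := by
  induction k generalizing z with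
  | zero => simp
  | succ k ih =>
    rw [Function.iterate_succ_apply', HolSpace.toFun_weightedComp isOpen_puncturedDisc hω hψ hm _ hz,
      ih (hm hz), hψl z hz, Finset.prod_range_succ']
    simp only [pow_zero, one_mul, pow_succ, mul_assoc]
    ring

/-- The zeros of a nonzero holomorphic function cannot meet every circle, as they do not accumulate
in `𝔻*`. -/
theorem exists_circle_forall_ne_zero {f : ℂ → ℂ} (hf : DifferentiableOn ℂ f puncturedDisc)
    (hne : ∃ z ∈ puncturedDisc, f z ≠ 0) :
    ∃ r : ℝ, 0 < r ∧ r < 1 ∧ ∀ z, ‖z‖ = r → f z ≠ 0 := by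
  by_contra! h
  set K : Set ℂ := Metric.closedBall 0 (1 / 2) \ Metric.ball 0 (1 / 4) with hK
  have hKc : IsCompact K := (isCompact_closedBall (0 : ℂ) (1 / 2)).diff Metric.isOpen_ball
  have hmemK : ∀ z, z ∈ K ↔ ‖z‖ ≤ 1 / 2 ∧ 1 / 4 ≤ ‖z‖ := fun z => by simp [hK]
  have hsurj : Icc (1 / 4 : ℝ) (1 / 2) ⊆ norm '' {z | z ∈ K ∧ f z = 0} := fun r hr => by
    obtain ⟨z, hz, hfz⟩ := h r (by linarith [hr.1]) (by linarith [hr.2])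
    exact ⟨z, ⟨(hmemK z).2 ⟨hz ▸ hr.2, hz ▸ hr.1⟩, hfz⟩, hz⟩
  have hinf : {z | z ∈ K ∧ f z = 0}.Infinite :=
    ((Icc_infinite (by norm_num)).mono hsurj).of_image norm
  obtain ⟨x, hx, hacc⟩ := hinf.exists_accPt_of_subset_isCompact hKc fun z hz => hz.1
  have hxD : x ∈ puncturedDisc := by
    have := (hmemK x).1 hx
    exact mem_puncturedDisc.2 ⟨by linarith, norm_pos_iff.1 (by linarith)⟩
  have hfreq : ∃ᶠ z in 𝓝[≠] x, f z = 0 := by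
    rw [frequently_nhdsWithin_iff]
    exact (accPt_iff_frequently.1 hacc).mono fun z hz => ⟨hz.2.2, hz.1⟩
  obtain ⟨z, hz, hfz⟩ := hne
  exact hfz ((hf.analyticOnNhd isOpen_puncturedDisc).eqOn_zero_of_preconnected_of_frequently_eq_zero
    isPreconnected_puncturedDisc hxD hfreq hz)

/-- On a circle without zeros of `f`, some iterate of `f` is small and some iterate is large. The
weight cocycle `P k` of the rotation would then satisfy `|P k| ≤ 1/2` and `|P m| ≥ 2` on the circle,
which gives contradictory bounds for `P (k m)`. -/
theorem not_hypercyclic_of_rotation {l : ℂ} (hl : ‖l‖ = 1) (hψl : ∀ z ∈ puncturedDisc, ψ z = l * z) :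
    ¬ LinDyn.Hypercyclic (weightedComp puncturedDisc isOpen_puncturedDisc ω ψ hω hψ hm) := by
  rintro ⟨f, hf⟩
  have hne : ∃ z ∈ puncturedDisc, HolSpace.toFun f z ≠ 0 := by
    by_contra! h0
    have hf0 : f = 0 := HolSpace.ext_toFun fun z hz => by rw [h0 z hz, HolSpace.toFun_zero]
    have hmem : (1 / 2 : ℂ) ∈ puncturedDisc := mem_puncturedDisc.2 ⟨by norm_num, by norm_num⟩
    obtain ⟨n, hn⟩ := LinDyn.Hypercyclic.exists_iterate_approx hf (singleton_subset_iff.2 hmem)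
      isCompact_singleton (HolSpace.ofDiff (fun _ => 1) (differentiableOn_const 1)) one_pos
    have h1 := hn _ rfl
    rw [hf0, iterate_map_zero, HolSpace.toFun_zero, HolSpace.toFun_ofDiff _ hmem] at h1
    norm_num at h1
  obtain ⟨r, hr0, hr1, hr⟩ := exists_circle_forall_ne_zero (HolSpace.differentiableOn_toFun f) hne
  set S := Metric.sphere (0 : ℂ) r with hS
  have hSD : S ⊆ puncturedDisc := fun z hz => by
    rw [hS, mem_sphere_zero_iff_norm] at hz
    exact mem_puncturedDisc.2 ⟨hz ▸ hr1, norm_pos_iff.1 (hz ▸ hr0)⟩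
  have hSc : IsCompact S := isCompact_sphere 0 r
  have hrot : ∀ k : ℕ, ∀ z ∈ S, l ^ k * z ∈ S := fun k z hz => by
    rw [hS, mem_sphere_zero_iff_norm] at hz ⊢
    rw [norm_mul, norm_pow, hl, one_pow, one_mul, hz]
  have hSne : S.Nonempty := NormedSpace.sphere_nonempty.2 hr0.le
  have hfc : ContinuousOn (fun z => ‖HolSpace.toFun f z‖) S :=
    ((HolSpace.differentiableOn_toFun f).continuousOn.mono hSD).norm
  obtain ⟨a, ha, hamin⟩ := hSc.exists_isMinOn hSne hfc
  obtain ⟨b, hb, hbmax⟩ := hSc.exists_isMaxOn hSne hfc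
  set A := ‖HolSpace.toFun f a‖ with hA
  set B := ‖HolSpace.toFun f b‖ with hB
  have hA0 : 0 < A := norm_pos_iff.2 (hr a (by simpa [hS] using ha))
  have hB0 : 0 < B := norm_pos_iff.2 (hr b (by simpa [hS] using hb))
  let P : ℕ → ℂ → ℂ := fun k z => ∏ j ∈ Finset.range k, ω (l ^ j * z)
  have hP : ∀ m k z, P (m + k) z = P m z * P k (l ^ m * z) := fun m k z => by
    simp only [P, Finset.prod_range_add, pow_add]
    congr 1
    exact Finset.prod_congr rfl fun j _ => by ring_nf
  obtain ⟨k, hk⟩ := LinDyn.Hypercyclic.exists_iterate_approx hf hSD hSc 0 (half_pos hA0)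
  obtain ⟨m, hm'⟩ := LinDyn.Hypercyclic.exists_iterate_approx hf hSD hSc
    (HolSpace.ofDiff (fun _ => ((2 * B + 1 : ℝ) : ℂ)) (differentiableOn_const _)) one_pos
  have hPk : ∀ z ∈ S, ‖P k z‖ ≤ 1 / 2 := fun z hz => by
    have h1 := hk z hz
    rw [HolSpace.toFun_zero, zero_sub, norm_neg,
      toFun_iterate_rotation hψl f k (hSD hz), norm_mul] at h1
    have h2 : A ≤ ‖HolSpace.toFun f (l ^ k * z)‖ := hamin (hrot k z hz)
    by_contra! h3
    have : 1 / 2 * A < ‖P k z‖ * ‖HolSpace.toFun f (l ^ k * z)‖ :=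
      mul_lt_mul h3 h2 hA0 (norm_nonneg _)
    linarith
  have hPm : ∀ z ∈ S, 2 ≤ ‖P m z‖ := fun z hz => by
    have h1 := hm' z hz
    rw [HolSpace.toFun_ofDiff _ (hSD hz), toFun_iterate_rotation hψl f m (hSD hz)] at h1
    have h2 : ‖HolSpace.toFun f (l ^ m * z)‖ ≤ B := hbmax (hrot m z hz)
    have h3 := norm_sub_norm_le ((2 * B + 1 : ℝ) : ℂ) (P m z * HolSpace.toFun f (l ^ m * z))
    rw [Complex.norm_real, Real.norm_of_nonneg (by positivity), norm_mul] at h3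
    have h4 := h3.trans h1.le
    have h5 : ‖P m z‖ * ‖HolSpace.toFun f (l ^ m * z)‖ ≤ ‖P m z‖ * B :=
      mul_le_mul_of_nonneg_left h2 (norm_nonneg _)
    by_contra! h6
    nlinarith
  have hup : ∀ i, ∀ z ∈ S, ‖P (i * k) z‖ ≤ (1 / 2) ^ i := fun i => by
    induction i with
    | zero => intro z _; simp [P]
    | succ i ih =>
      intro z hz
      rw [add_mul, one_mul, hP, norm_mul, pow_succ]
      exact mul_le_mul (ih z hz) (hPk _ (hrot _ z hz)) (norm_nonneg _) (by positivity)
  have hlow : ∀ i, ∀ z ∈ S, 2 ^ i ≤ ‖P (i * m) z‖ := fun i => by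
    induction i with
    | zero => intro z _; simp [P]
    | succ i ih =>
      intro z hz
      rw [add_mul, one_mul, hP, norm_mul, pow_succ]
      exact mul_le_mul (ih z hz) (hPm _ (hrot _ z hz)) (by norm_num) (norm_nonneg _)
  have h1 := hup m a ha
  have h2 := hlow k a ha
  rw [mul_comm k m] at h2
  have hm0 : m ≠ 0 := by
    rintro rfl
    have := hPm a ha
    simp [P] at this
  have h3 : ((1 : ℝ) / 2) ^ m < 1 := pow_lt_one₀ (by norm_num) (by norm_num) hm0
  have h4 : (1 : ℝ) ≤ 2 ^ k := one_le_pow₀ (by norm_num)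
  linarith

end Necessity

/-! ### Positivity of the winding number of the weight -/

/-- The constant Laurent coefficient of `F (l w)` is that of `F w`. -/
theorem circleAverage_comp_mul {F : ℂ → ℂ} {R ρ : ℝ} {l : ℂ}
    (hF : DifferentiableOn ℂ F (Metric.ball 0 R \ {0})) (hρ : 0 < ρ) (hρR : ρ < R) (hl0 : l ≠ 0)
    (hl : ‖l‖ < 1) : Real.circleAverage (fun w => F (l * w)) 0 ρ = Real.circleAverage F 0 ρ := by
  have hlpos := norm_pos_iff.2 hl0
  have hsmall : 0 < ‖l‖ * ρ := mul_pos hlpos hρ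
  have hmem : ∀ z : ℂ, ‖l‖ * ρ ≤ ‖z‖ → ‖z‖ ≤ ρ → z ∈ Metric.ball (0 : ℂ) R \ {0} := fun z h1 h2 =>
    ⟨by simpa using h2.trans_lt hρR, norm_pos_iff.1 (hsmall.trans_le h1)⟩
  -- the argument of `l` is absorbed by a rotation, its modulus by Cauchy's theorem
  have h1 : Real.circleAverage (fun w => F (l * w)) 0 ρ = Real.circleAverage F 0 (‖l‖ * ρ) := by
    rw [Real.circleAverage_eq_integral_add (f := F) l.arg, Real.circleAverage_def]
    congr 2
    funext θ
    congr 1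
    simp only [circleMap_zero]
    push_cast
    rw [add_mul, Complex.exp_add]
    linear_combination -(ρ * Complex.exp (θ * Complex.I)) * Complex.norm_mul_exp_arg_mul_I l
  have hcont : ContinuousOn F (Metric.closedBall 0 ρ \ Metric.ball 0 (‖l‖ * ρ)) :=
    hF.continuousOn.mono fun z hz => hmem z (by simpa using hz.2) (by simpa using hz.1)
  rw [h1, Real.circleAverage_eq_circleIntegral hsmall.ne', Real.circleAverage_eq_circleIntegral hρ.ne',
    Complex.circleIntegral_sub_center_inv_smul_eq_of_differentiable_on_annulus_off_countable hsmall
      (mul_le_of_le_one_left hρ.le hl.le) countable_empty hcont]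
  intro z hz
  rw [sdiff_empty] at hz
  exact hF.differentiableAt ((Metric.isOpen_ball.sdiff isClosed_singleton).mem_nhds
    (hmem z (le_of_lt (by simpa using hz.2)) (le_of_lt (by simpa using hz.1))))

theorem norm_circleAverage_le {F : ℂ → ℂ} {ρ C : ℝ} (hρ : 0 ≤ ρ) (hF : ∀ z, ‖z‖ = ρ → ‖F z‖ ≤ C) :
    ‖Real.circleAverage F 0 ρ‖ ≤ C := by
  rw [Real.circleAverage_def, norm_smul]
  have h1 := intervalIntegral.norm_integral_le_of_norm_le_const (a := 0) (b := 2 * Real.pi)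
    (f := fun θ => F (circleMap 0 ρ θ)) (C := C) fun θ _ =>
      hF _ (by rw [norm_circleMap_zero, abs_of_nonneg hρ])
  rw [sub_zero, abs_of_pos Real.two_pi_pos] at h1
  rw [norm_inv, Real.norm_of_nonneg Real.two_pi_pos.le, inv_mul_le_iff₀ Real.two_pi_pos]
  linarith

/-- In the coordinate `σ` and the gauge `g`, the Laurent coefficients `a m` of `f` satisfy
`a m (T f) = c λ^(m - n) a (m - n) (f)`. For `n = 0` the functional `a 0` is an eigenvector of the
adjoint. For `n < 0` the iterates lead from `a 0` to coefficients of large positive index, and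
`a 0` is bounded on each orbit. -/
theorem one_le_of_hypercyclic_of_model {ω ψ σ g : ℂ → ℂ} {c l : ℂ} {n : ℤ}
    {T : HolSpace puncturedDisc →L[ℂ] HolSpace puncturedDisc} (hT : LinDyn.Hypercyclic T)
    (hTf : ∀ f, ∀ z ∈ puncturedDisc, HolSpace.toFun (T f) z = ω z * HolSpace.toFun f (ψ z))
    (hm : MapsTo ψ puncturedDisc puncturedDisc) (hl0 : l ≠ 0) (hl : ‖l‖ < 1)
    (hσ : DifferentiableOn ℂ σ (Metric.ball 0 1)) (hi : InjOn σ (Metric.ball 0 1)) (h0 : σ 0 = 0)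
    (hσψ : ∀ z ∈ puncturedDisc, σ (ψ z) = l * σ z) (hg : DifferentiableOn ℂ g puncturedDisc)
    (hg0 : ∀ z, g z ≠ 0)
    (hmodel : ∀ z ∈ puncturedDisc, ω z * g (ψ z) = c * σ z ^ n * g z) : 1 ≤ n := by
  by_contra! hn
  have h0b : (0 : ℂ) ∈ Metric.ball (0 : ℂ) 1 := Metric.mem_ball_self one_pos
  obtain ⟨R, hR, hRσ⟩ := Metric.isOpen_iff.1 (isOpen_image_of_injOn Metric.isOpen_ball hσ hi) 0
    ⟨0, h0b, h0⟩
  set h := Function.invFunOn σ (Metric.ball 0 1) with hh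
  have hσh : ∀ w ∈ Metric.ball (0 : ℂ) R, σ (h w) = w := fun w hw =>
    Function.invFunOn_eq (hRσ hw)
  have hhσ : ∀ z ∈ Metric.ball (0 : ℂ) 1, h (σ z) = z := fun z hz => hi.leftInvOn_invFunOn hz
  have hmaps : MapsTo h (Metric.ball 0 R \ {0}) puncturedDisc := fun w hw =>
    ⟨Function.invFunOn_mem (hRσ hw.1), fun hw0 => hw.2 <| by
      rw [mem_singleton_iff, ← hσh w hw.1, mem_singleton_iff.1 hw0, h0]⟩
  have hhd : DifferentiableOn ℂ h (Metric.ball 0 R \ {0}) :=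
    (differentiableOn_invFunOn Metric.isOpen_ball hσ hi).mono fun w hw => hRσ hw.1
  have hghd : DifferentiableOn ℂ (fun w => g (h w)) (Metric.ball 0 R \ {0}) := hg.comp hhd hmaps
  obtain ⟨ρ, hρ, hρR⟩ := exists_between hR
  have hsph : ∀ w : ℂ, ‖w‖ = ρ → w ∈ Metric.ball (0 : ℂ) R \ {0} := fun w hw =>
    ⟨by simpa [hw] using hρR, norm_pos_iff.1 (hw ▸ hρ)⟩
  have hsub : Metric.sphere (0 : ℂ) ρ ⊆ Metric.ball 0 R \ {0} := fun w hw => hsph w (by simpa using hw)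
  let F : HolSpace puncturedDisc → ℂ → ℂ := fun f w => HolSpace.toFun f (h w) / g (h w)
  have hF : ∀ f, DifferentiableOn ℂ (F f) (Metric.ball 0 R \ {0}) := fun f =>
    ((HolSpace.differentiableOn_toFun f).comp hhd hmaps).div hghd fun w _ => hg0 _
  have hFT : ∀ f, ∀ w ∈ Metric.ball (0 : ℂ) R \ {0}, F (T f) w = c * w ^ n * F f (l * w) :=
    fun f w hw => by
      have hz := hmaps hw
      have h1 : h (l * w) = ψ (h w) := by
        rw [← hhσ _ (hm hz).1, hσψ _ hz, hσh w hw.1]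
      have h2 := hmodel _ hz
      rw [hσh w hw.1] at h2
      simp only [F]
      rw [hTf f _ hz, h1, div_eq_iff (hg0 _), mul_div_assoc', div_mul_eq_mul_div,
        eq_div_iff (hg0 _)]
      linear_combination HolSpace.toFun f (ψ (h w)) * h2
  let a : ℤ → HolSpace puncturedDisc → ℂ := fun m f =>
    Real.circleAverage (fun w => w ^ (-m) * F f w) 0 ρ
  have haT : ∀ m f, a m (T f) = c * l ^ (m - n) * a (m - n) f := fun m f => by
    have hd : DifferentiableOn ℂ (fun w => w ^ (-(m - n)) * F f w) (Metric.ball 0 R \ {0}) :=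
      (differentiableOn_id.zpow (Or.inl fun w hw => hw.2)).mul (hF f)
    simp only [a]
    rw [← circleAverage_comp_mul hd hρ hρR hl0 hl, ← smul_eq_mul (c * l ^ (m - n)),
      ← Real.circleAverage_fun_smul]
    refine Real.circleAverage_congr_sphere fun w hw => ?_
    rw [abs_of_pos hρ] at hw
    have hw0 := (hsub hw).2
    simp only [smul_eq_mul]
    rw [hFT f w (hsub hw), mul_zpow, zpow_neg l (m - n), neg_sub, sub_eq_add_neg n m,
      zpow_add₀ hw0]
    have := zpow_ne_zero (m - n) hl0
    field_simp
  obtain ⟨L, hLc, hL⟩ := HolSpace.exists_circleAverage_functional isOpen_puncturedDisc hρ.le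
    (k := fun w => (g (h w))⁻¹) (γ := h)
    ((hghd.continuousOn.mono hsub).inv₀ fun w _ => hg0 _) (hhd.continuousOn.mono hsub)
    (hmaps.mono_left hsub)
  have hLa : ∀ f, L f = a 0 f := fun f => by
    rw [hL]
    simp only [a, F, neg_zero, zpow_zero, one_mul, div_eq_inv_mul]
  have hLg : L (HolSpace.ofDiff g hg) = 1 := by
    rw [hL, Real.circleAverage_congr_sphere (f₂ := fun _ => 1), Real.circleAverage_const]
    intro w hw
    rw [abs_of_pos hρ] at hw
    simp only
    rw [HolSpace.toFun_ofDiff hg (hmaps (hsub hw)), inv_mul_cancel₀ (hg0 _)]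
  have hL0 : L ≠ 0 := fun hz => by
    rw [hz] at hLg
    exact zero_ne_one hLg
  refine hL0 ?_
  rcases (Int.lt_add_one_iff.1 hn : n ≤ 0).eq_or_lt with rfl | hneg
  · refine hT.eq_zero_of_comp_eq_smul L hLc (c := c) fun f => ?_
    rw [hLa, hLa, haT, sub_zero, zpow_zero, mul_one]
  · obtain ⟨N, hN⟩ : ∃ N : ℕ, n = -(N : ℤ) := ⟨n.natAbs, by omega⟩
    have hN0 : N ≠ 0 := by rintro rfl; simp [hN] at hneg
    have hiter : ∀ (k : ℕ) (m : ℤ) f,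
        a m (T^[k] f) = (∏ j ∈ Finset.range k, c * l ^ (m + (j + 1) * N)) * a (m + k * N) f :=
      fun k => by
        induction k with
        | zero => intro m f; simp
        | succ k ih =>
          intro m f
          rw [Function.iterate_succ_apply', haT, hN, sub_neg_eq_add, ih, Finset.prod_range_succ']
          have hp : ∀ j : ℕ, m + N + ((j : ℤ) + 1) * N = m + (((j + 1 : ℕ) : ℤ) + 1) * N := fun j => by
            push_cast; ring
          simp only [hp]
          rw [show m + N + (k : ℤ) * N = m + ((k + 1 : ℕ) : ℤ) * N by push_cast; ring]
          push_cast
          ring_nf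
    refine hT.eq_zero_of_bounded L hLc fun f => ?_
    obtain ⟨C, hC⟩ := ((isCompact_sphere (0 : ℂ) ρ).image_of_continuousOn
      ((hF f).continuousOn.mono hsub)).isBounded.exists_norm_le
    have hq : ‖l‖ ^ N < 1 := pow_lt_one₀ (norm_nonneg l) hl hN0
    have hA : 0 ≤ ‖c‖ * ‖l‖ ^ N * (ρ ^ N)⁻¹ := by positivity
    have hs := summable_prod_const_mul_pow hA (by positivity) hq
    refine ⟨(∑' k : ℕ, ∏ j ∈ Finset.range k, ‖c‖ * ‖l‖ ^ N * (ρ ^ N)⁻¹ * (‖l‖ ^ N) ^ j) * C,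
      fun k => ?_⟩
    have hC0 : 0 ≤ C := (norm_nonneg _).trans (hC _ (mem_image_of_mem _
      (show (ρ : ℂ) ∈ Metric.sphere (0 : ℂ) ρ by simp [abs_of_pos hρ])))
    have hak : ‖a (0 + k * N) f‖ ≤ ((ρ ^ N)⁻¹) ^ k * C := by
      refine norm_circleAverage_le hρ.le fun w hw => ?_
      rw [norm_mul, norm_zpow, hw, zero_add, zpow_neg, mul_comm (k : ℤ), zpow_mul, zpow_natCast,
        zpow_natCast, inv_pow]
      gcongr
      exact hC _ (mem_image_of_mem _ (by simpa using hw))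
    rw [hLa, hiter, norm_mul, norm_prod]
    calc _ ≤ (∏ j ∈ Finset.range k, ‖c * l ^ (0 + ((j : ℤ) + 1) * N)‖) * (((ρ ^ N)⁻¹) ^ k * C) := by
          gcongr
      _ = (∏ j ∈ Finset.range k, ‖c‖ * ‖l‖ ^ N * (ρ ^ N)⁻¹ * (‖l‖ ^ N) ^ j) * C := by
          have : ∀ j : ℕ, ‖c * l ^ (0 + ((j : ℤ) + 1) * N)‖ = ‖c‖ * ‖l‖ ^ N * (‖l‖ ^ N) ^ j :=
            fun j => by
              rw [norm_mul, norm_zpow, zero_add, mul_comm ((j : ℤ) + 1), zpow_mul, zpow_natCast,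
                zpow_add_one₀ (pow_ne_zero _ (norm_ne_zero_iff.2 hl0)), zpow_natCast]
              ring
          simp only [this, mul_right_comm _ (ρ ^ N)⁻¹, Finset.prod_mul_distrib, Finset.prod_const,
            Finset.card_range]
          ring
      _ ≤ _ := by
          refine mul_le_mul_of_nonneg_right (hs.le_tsum k fun j _ => ?_) hC0
          exact Finset.prod_nonneg fun i _ => by positivity

/-! ### The equivalence -/

/-- Hypercyclicity makes `ω` zero-free and `ψ` injective with fixed point `0`. Were `|ψ'(0)| = 1`, then
`ψ` would be a rotation, so `ψ'(0) = λ` with `|λ| < 1` and the linear model is available; it shows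
that the winding number of `ω` is positive. -/
theorem exists_weight_of_hypercyclic {ω ψ : ℂ → ℂ} {hω : DifferentiableOn ℂ ω puncturedDisc}
    {hψ : DifferentiableOn ℂ ψ puncturedDisc} {hm : MapsTo ψ puncturedDisc puncturedDisc}
    (hT : LinDyn.Hypercyclic (weightedComp puncturedDisc isOpen_puncturedDisc ω ψ hω hψ hm)) :
    (∃ n : ℕ, 1 ≤ n ∧ ∃ W : ℂ → ℂ, DifferentiableOn ℂ W puncturedDisc ∧
        ∀ z ∈ puncturedDisc, ω z = z ^ n * Complex.exp (W z)) ∧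
      InjOn ψ puncturedDisc ∧ ¬ SurjOn ψ puncturedDisc puncturedDisc ∧
      Tendsto ψ (𝓝[puncturedDisc] 0) (𝓝 0) := by
  have hi := injOn_of_hypercyclic hT
  obtain ⟨Ψ, hΨ, hΨψ⟩ := exists_extension_of_mapsTo hψ hm
  have hΨ0 := extension_zero_eq_zero_of_hypercyclic hT hΨ hΨψ
  have hΨm := mapsTo_ball_of_extension hm hΨψ hΨ0
  have hΨi := injOn_ball_of_extension hm hi hΨψ hΨ0
  have hd : ‖deriv Ψ 0‖ < 1 := by
    by_contra! h1
    refine not_hypercyclic_of_rotation ((norm_deriv_zero_le_one hΨ hΨm hΨ0).antisymm h1)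
      (fun z hz => ?_) hT
    rw [← hΨψ z hz.2, eq_deriv_mul_of_one_le_norm_deriv hΨ hΨm hΨ0 h1 hz.1]
  have hd0 := deriv_ne_zero_of_injOn Metric.isOpen_ball hΨ hΨi (Metric.mem_ball_self one_pos)
  obtain ⟨n, W, hW, hωW⟩ := exists_eq_zpow_mul_exp hω fun z hz => weight_ne_zero_of_hypercyclic hT hz
  obtain ⟨σ, g, c, hσ, hσi, hσ0, hσΨ, hg, hg0, -, hmodel⟩ :=
    exists_linear_model hΨ hΨm hΨ0 hd hΨi hW hωW
  have hn : 1 ≤ n := one_le_of_hypercyclic_of_model hT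
    (fun f z hz => HolSpace.toFun_weightedComp isOpen_puncturedDisc hω hψ hm f hz) hm hd0 hd
    hσ hσi hσ0 (fun z hz => by rw [← hΨψ z hz.2, hσΨ z hz.1]) hg hg0
    fun z hz => by rw [← hΨψ z hz.2, hmodel z hz]
  lift n to ℕ using by omega
  refine ⟨⟨n, by exact_mod_cast hn, W, hW, by simpa only [zpow_natCast] using hωW⟩, hi,
    fun hs => ?_, ?_⟩
  · refine absurd (one_le_norm_deriv_of_surjOn hΨ hΨi hΨ0 fun w hw => ?_) (not_le.2 hd)
    by_cases hw0 : w = 0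
    · exact ⟨0, Metric.mem_ball_self one_pos, by rw [hΨ0, hw0]⟩
    · obtain ⟨z, hz, hzw⟩ := hs ⟨hw, hw0⟩
      exact ⟨z, hz.1, by rw [hΨψ z hz.2, hzw]⟩
  · have h1 : Tendsto Ψ (𝓝[puncturedDisc] 0) (𝓝 (Ψ 0)) :=
      (hΨ.continuousOn.continuousAt (Metric.ball_mem_nhds 0 one_pos)).tendsto.mono_left
        nhdsWithin_le_nhds
    rw [hΨ0] at h1
    refine h1.congr' ?_
    filter_upwards [self_mem_nhdsWithin] with z hz using hΨψ z hz.2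

theorem HolSpace.dynamics_of_criterion {T : HolSpace puncturedDisc →L[ℂ] HolSpace puncturedDisc}
    (h : LinDyn.FrequentHypercyclicityCriterion T) :
    LinDyn.FrequentlyHypercyclic T ∧ LinDyn.Mixing T ∧ LinDyn.Chaotic T := by
  -- pass to the additive structure that underlies the group structure
  have h' : @LinDyn.FrequentHypercyclicityCriterion (HolSpace puncturedDisc)
      AddCommGroup.toAddCommMonoid _ _ T := h
  have hb := h'.hasSummableBiorbits
  exact ⟨hb.frequentlyHypercyclic, hb.mixing, hb.chaotic⟩

theorem theorem1p4 (ω ψ : ℂ → ℂ)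
    (hω : DifferentiableOn ℂ ω puncturedDisc)
    (hψ : DifferentiableOn ℂ ψ puncturedDisc)
    (hm : MapsTo ψ puncturedDisc puncturedDisc) :
    [ LinDyn.Hypercyclic (weightedComp puncturedDisc isOpen_puncturedDisc ω ψ hω hψ hm),
      LinDyn.FrequentHypercyclicityCriterion (weightedComp puncturedDisc isOpen_puncturedDisc ω ψ hω hψ hm),
      (∃ n : ℕ, 1 ≤ n ∧ ∃ W : ℂ → ℂ, DifferentiableOn ℂ W puncturedDisc ∧
          ∀ z ∈ puncturedDisc, ω z = z ^ n * Complex.exp (W z)) ∧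
        InjOn ψ puncturedDisc ∧ ¬ SurjOn ψ puncturedDisc puncturedDisc ∧
        Tendsto ψ (𝓝[puncturedDisc] 0) (𝓝 0) ].TFAE ∧
    (LinDyn.FrequentHypercyclicityCriterion (weightedComp puncturedDisc isOpen_puncturedDisc ω ψ hω hψ hm) →
      LinDyn.FrequentlyHypercyclic (weightedComp puncturedDisc isOpen_puncturedDisc ω ψ hω hψ hm) ∧
      LinDyn.Mixing (weightedComp puncturedDisc isOpen_puncturedDisc ω ψ hω hψ hm) ∧
      LinDyn.Chaotic (weightedComp puncturedDisc isOpen_puncturedDisc ω ψ hω hψ hm)) := by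
  refine ⟨?_, HolSpace.dynamics_of_criterion⟩
  tfae_have 1 → 3 := exists_weight_of_hypercyclic
  tfae_have 3 → 2 := by
    rintro ⟨⟨n, hn, W, hW, hωW⟩, hi, hs, h0⟩
    exact frequentHypercyclicityCriterion_weightedComp hω hψ hm hn hW hωW hi hs h0
  tfae_have 2 → 1 := fun h => (HolSpace.dynamics_of_criterion h).1.hypercyclic
  tfae_finish
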